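/- Let $\mathbb K$ be an algebraically closed field of characteristic zero, let $a\in\mathbb K\setminus\{0,-1\}$, and let $\mathfrak g=D(2,1;a)$ be the contragredient Lie superalgebra over $\mathbb K$ with Cartan matrix $\begin{pmatrix}0&1&a\\-1&2&0\\-1&0&2\end{pmatrix}$ and Chevalley generators $h_i,e_i,f_i$ ($i=1,2,3$), of which only $e_1,f_1$ are odd. Let $\mathfrak h=\sum_i\mathbb K h_i$ be its Cartan subalgebra and $\Delta=\Delta_0\sqcup\Delta_1$ its set of (even and odd) roots, $\Delta_0=\{\pm2\varepsilon_i\}$, $\Delta_1=\{\pm\varepsilon_1\pm\varepsilon_2\pm\varepsilon_3\}$, where the $\varepsilon_i$ form an orthogonal basis of $\mathfrak h^*$ for the form with $(\varepsilon_1,\varepsilon_1)=-\frac{1+a}2$, $(\varepsilon_2,\varepsilon_2)=\frac12$, $(\varepsilon_3,\varepsilon_3)=\frac a2$. The coroots $H_\alpha\in\mathfrak h$ are normalized so that $\beta(H_\alpha)=2(\alpha,\beta)/(\alpha,\alpha)$ for $\alpha\in\Delta_0$, and $\beta(H_\alpha)=-(\alpha,\beta)$ for $\alpha\in\Delta_1$,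 for all $\beta\in\mathfrak h^*$. Let $\mathbb Z[a]$ be the subring of $\mathbb K$ generated by $a$, and $\mathbb Z_a$ the subring of $\mathbb K$ generated by all $\binom{P}{n}$ with $P\in\mathbb Z[a]$ and $n\in\mathbb N$. For a subring $R\subseteq\mathbb K$, an $R$-lattice in a $\mathbb K$-vector space is the $R$-span of a $\mathbb K$-basis. Fix a Chevalley basis $\{H_1,H_2,H_3\}\cup\{X_\alpha\}_{\alpha\in\Delta}$ of $\mathfrak g$, that is, a homogeneous $\mathbb K$-basis such that: $H_1,H_2,H_3$ is a basis of $\mathfrak h$ whose $\mathbb Z[a]$-span equals the $\mathbb Z[a]$-span $\mathfrak h_{\mathbb Z[a]}$ of all coroots; $[H_i,H_j]=0$ and $[H_i,X_\alpha]=\alpha(H_i)X_\alpha$; $[X_\alpha,X_{-\alpha}]=\sigma_\alpha H_\alpha$, with $\sigma_\alpha=-1$ if $\alpha$ is a negative odd root (one of $-\varepsilon_1\pm\varepsilon_2\pm\varepsilon_3$) and $\sigma_\alpha=1$ otherwise; and, for $\alpha,\beta\in\Delta$ with $\alpha+\beta\ne0$: $[X_\alpha,X_\beta]=0$ if $\alpha+\beta\notin\Delta$,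 while if $\alpha+\beta\in\Delta$, then $[X_\alpha,X_\beta]=\pm(r+1)X_{\alpha+\beta}$ when $\alpha$ or $\beta$ is non-isotropic, $\beta-r\alpha,\dots,\beta+q\alpha$ being the $\alpha$-string through $\beta$ in $\Delta\cup\{0\}$, and $[X_\alpha,X_\beta]=\pm\beta(H_\alpha)X_{\alpha+\beta}$ when both are isotropic. The Kostant superalgebra is the unital $\mathbb Z_a$-subalgebra of the universal enveloping superalgebra $U(\mathfrak g)$ generated by $X_\alpha^n/n!$ ($\alpha\in\Delta_0$, $n\in\mathbb N$), $X_\gamma$ ($\gamma\in\Delta_1$) and $\binom Hn$ ($H\in\mathfrak h_{\mathbb Z[a]}$, $n\in\mathbb N$). Let $V$ be a finite dimensional $\mathfrak g$-module which is faithful and rational; rational means that $V$ is the direct sum of its weight spaces $V_\mu$ ($\mu\in\mathfrak h^*$) and that for every weight $\mu$ of $V$ one has $\mu(H_i)\in\mathbb Z[a]$ for $i=1,2,3$ and $\mu(H_\alpha)\in\mathbb Z$ for all $\alpha\in\Delta_0$. Let $M$ be an admissible lattice of $V$, that is, a $\mathbb Z_a$-lattice in $V$ stable under the Kostant superalgebra,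 and let $\mathfrak g_V=\{X\in\mathfrak g : X.M\subseteq M\}$. Then $$\mathfrak g_V=\mathfrak h_V\oplus\Big(\bigoplus_{\alpha\in\Delta}\mathbb Z_a X_\alpha\Big),\qquad \mathfrak h_V=\{H\in\mathfrak h : \mu(H)\in\mathbb Z_a \text{ for all weights } \mu \text{ of } V\}.$$ In particular, $\mathfrak g_V$ is a $\mathbb Z_a$-lattice in $\mathfrak g$, and it does not depend on the choice of the admissible lattice $M$ of $V$. -/

import Mathlib

open scoped Nat

noncomputable section

/-! ### Lie superalgebras, their modules and enveloping algebras -/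

/-- The sign `(-1) ^ (i * j)` of two parities. -/
def superSign (K : Type*) [Field K] (i j : ZMod 2) : K := if i = 1 ∧ j = 1 then -1 else 1

/-- A Lie superalgebra structure over `K` on the vector space `g`. -/
structure LieSuperalgebra (K g : Type*) [Field K] [AddCommGroup g] [Module K g] where
  part : ZMod 2 → Submodule K g
  isCompl : IsCompl (part 0) (part 1)
  bracket : g →ₗ[K] g →ₗ[K] g
  bracket_mem : ∀ i j : ZMod 2, ∀ x ∈ part i, ∀ y ∈ part j, bracket x y ∈ part (i + j)
  skew : ∀ i j : ZMod 2, ∀ x ∈ part i, ∀ y ∈ part j,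
    bracket x y + superSign K i j • bracket y x = 0
  jacobi : ∀ i j k : ZMod 2, ∀ x ∈ part i, ∀ y ∈ part j, ∀ z ∈ part k,
    superSign K i k • bracket x (bracket y z) + superSign K j i • bracket y (bracket z x)
      + superSign K k j • bracket z (bracket x y) = 0

namespace LieSuperalgebra

variable {K g : Type*} [Field K] [AddCommGroup g] [Module K g]

/-- A module over a Lie superalgebra: a representation on `V` in which brackets of homogeneous
elements act as supercommutators.  No grading of `V` is required; a `ℤ/2`-graded module is in
particular a module in this sense. -/
structure Rep (L : LieSuperalgebra K g) (V : Type*) [AddCommGroup V] [Module K V] where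
  toHom : g →ₗ[K] Module.End K V
  map_bracket : ∀ i j : ZMod 2, ∀ x ∈ L.part i, ∀ y ∈ L.part j,
    toHom (L.bracket x y) = toHom x * toHom y - superSign K i j • (toHom y * toHom x)

/-- The relations `x y = (-1) ^ (|x| |y|) y x + [x, y]` on the tensor algebra. -/
inductive EnvRel (L : LieSuperalgebra K g) : TensorAlgebra K g → TensorAlgebra K g → Prop
  | mk (i j : ZMod 2) (x y : g) (hx : x ∈ L.part i) (hy : y ∈ L.part j) :
      EnvRel L (TensorAlgebra.ι K x * TensorAlgebra.ι K y)
        (superSign K i j • (TensorAlgebra.ι K y * TensorAlgebra.ι K x)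
          + TensorAlgebra.ι K (L.bracket x y))

/-- The universal enveloping superalgebra `U(g)`, as an associative algebra. -/
def Env (L : LieSuperalgebra K g) : Type _ := RingQuot (EnvRel L)

instance (L : LieSuperalgebra K g) : Ring (Env L) := inferInstanceAs (Ring (RingQuot (EnvRel L)))

instance (L : LieSuperalgebra K g) : Algebra K (Env L) :=
  inferInstanceAs (Algebra K (RingQuot (EnvRel L)))

/-- The canonical map `g → U(g)`. -/
def Env.of (L : LieSuperalgebra K g) : g →ₗ[K] Env L :=
  (RingQuot.mkAlgHom K (EnvRel L)).toLinearMap ∘ₗ TensorAlgebra.ι K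

/-- The action of `U(g)` on a `g`-module. -/
def Rep.envAction {L : LieSuperalgebra K g} {V : Type*} [AddCommGroup V] [Module K V]
    (ρ : Rep L V) : Env L →ₐ[K] Module.End K V :=
  RingQuot.liftAlgHom K ⟨TensorAlgebra.lift K ρ.toHom, by
    rintro _ _ ⟨i, j, x, y, hx, hy⟩
    simp [ρ.map_bracket i j x hx y hy]⟩

theorem Rep.envAction_of {L : LieSuperalgebra K g} {V : Type*} [AddCommGroup V] [Module K V]
    (ρ : Rep L V) (x : g) : ρ.envAction (Env.of L x) = ρ.toHom x := by
  simp only [Rep.envAction, Env.of]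
  erw [RingQuot.liftAlgHom_mkAlgHom_apply]
  simp

/-- The submodule `{x ∈ g | x . M ⊆ M}`, for an `R`-submodule `M` of `V`. -/
def Rep.stabilizer {L : LieSuperalgebra K g} {V : Type*} [AddCommGroup V] [Module K V]
    (ρ : Rep L V) {R : Subring K} (M : Submodule R V) : Submodule R g where
  carrier := {x | ∀ m ∈ M, ρ.toHom x m ∈ M}
  zero_mem' := by intro m _; simp
  add_mem' := by
    intro x y hx hy m hm
    simpa using M.add_mem (hx m hm) (hy m hm)
  smul_mem' := by
    intro c x hx m hm
    have h := M.smul_mem c (hx m hm)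
    rw [Subring.smul_def] at h ⊢
    simpa using h

end LieSuperalgebra

/-- `M` is an `R`-lattice of `V`: the `R`-span of some `K`-basis `s` of `V`. -/
def IsLatticeOver {K V : Type*} [Field K] [AddCommGroup V] [Module K V] (R : Subring K)
    (M : Submodule R V) : Prop :=
  ∃ s : Set V, LinearIndepOn K id s ∧ Submodule.span K s = ⊤ ∧ M = Submodule.span R s

/-- The binomial coefficient `y (y - 1) ⋯ (y - n + 1) / n!` in a `K`-algebra. -/
def binomCoeff (K : Type*) {A : Type*} [Field K] [Ring A] [Algebra K A] (y : A) (n : ℕ) : A :=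
  ((n ! : K)⁻¹) • Polynomial.aeval y (descPochhammer K n)

/-- The divided power `y ^ n / n!` in a `K`-algebra. -/
def dividedPow (K : Type*) {A : Type*} [Field K] [Ring A] [Algebra K A] (y : A) (n : ℕ) : A :=
  ((n ! : K)⁻¹) • y ^ n

/-! ### The Lie superalgebra `D(2,1;a)` -/

namespace D21

variable {K : Type*} [Field K]

/-- The odd part `K² ⊗ K² ⊗ K²`, in coordinates. -/
abbrev Odd (K : Type*) := Fin 2 → Fin 2 → Fin 2 → K

/-- The underlying space `(sl₂ ⊕ sl₂ ⊕ sl₂) ⊕ (K² ⊗ K² ⊗ K²)` of `D(2,1;a)`. -/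
abbrev Carrier (K : Type*) [Field K] :=
  (Fin 3 → LieAlgebra.SpecialLinear.sl (Fin 2) K) × Odd K

/-- The scalars `σ = (-(1 + a) / 2, 1 / 2, a / 2)`. -/
def sigma (a : K) : Fin 3 → K := ![-(1 + a) / 2, 1 / 2, a / 2]

/-- The tensor product action of `sl₂ ⊕ sl₂ ⊕ sl₂` on `K² ⊗ K² ⊗ K²`. -/
def act (x : Fin 3 → LieAlgebra.SpecialLinear.sl (Fin 2) K) (v : Odd K) : Odd K := fun p q r =>
  ∑ t, (x 0).1 p t * v t q r + ∑ t, (x 1).1 q t * v p t r + ∑ t, (x 2).1 r t * v p q t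

/-- The symplectic form `ψ` on `K²`, on basis vectors: `ψ(e₀, e₁) = 1 = -ψ(e₁, e₀)`. -/
def psi (K : Type*) [Field K] : Matrix (Fin 2) (Fin 2) K := !![0, 1; -1, 0]

/-- The matrix `∑ c p q • P(e_p, e_q)`, where `P(u, w) ∈ sl₂` is the map
`z ↦ ψ(w, z) u + ψ(u, z) w`. -/
def symProd (c : Fin 2 → Fin 2 → K) : LieAlgebra.SpecialLinear.sl (Fin 2) K :=
  ⟨Matrix.of fun i j => ∑ p, ∑ q, c p q *
      (psi K q j * (if i = p then 1 else 0) + psi K p j * (if i = q then 1 else 0)), by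
    change Matrix.trace (n := Fin 2) (R := K) _ = 0
    simp [Matrix.trace, Fin.sum_univ_two, psi]
    ring⟩

/-- The bracket of odd elements: on pure tensors,
`[v₁ ⊗ v₂ ⊗ v₃, w₁ ⊗ w₂ ⊗ w₃] = ∑ σ i • ψ(v_j, w_j) ψ(v_k, w_k) P(v_i, w_i)`
with `{i, j, k} = {1, 2, 3}`. -/
def oddBracket (a : K) (v w : Odd K) : Fin 3 → LieAlgebra.SpecialLinear.sl (Fin 2) K :=
  ![sigma a 0 • symProd fun i j =>
      ∑ q, ∑ q', ∑ r, ∑ r', psi K q q' * psi K r r' * (v i q r * w j q' r'),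
    sigma a 1 • symProd fun i j =>
      ∑ p, ∑ p', ∑ r, ∑ r', psi K p p' * psi K r r' * (v p i r * w p' j r'),
    sigma a 2 • symProd fun i j =>
      ∑ p, ∑ p', ∑ q, ∑ q', psi K p p' * psi K q q' * (v p q i * w p' q' j)]


/-- The bracket of `sl₂ ⊕ sl₂ ⊕ sl₂`. -/
def evenBracket (x y : Fin 3 → LieAlgebra.SpecialLinear.sl (Fin 2) K) :
    Fin 3 → LieAlgebra.SpecialLinear.sl (Fin 2) K := fun i => ⁅x i, y i⁆

theorem sl_trace (x : LieAlgebra.SpecialLinear.sl (Fin 2) K) : x.1 1 1 = - x.1 0 0 := by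
  have h : Matrix.trace x.1 = 0 := x.2
  rw [Matrix.trace, Fin.sum_univ_two] at h
  simp only [Matrix.diag_apply] at h
  linear_combination h

theorem sl_ext {x y : LieAlgebra.SpecialLinear.sl (Fin 2) K} (h0 : x.1 0 0 = y.1 0 0)
    (h1 : x.1 0 1 = y.1 0 1) (h2 : x.1 1 0 = y.1 1 0) : x = y := by
  apply Subtype.ext
  ext p q
  fin_cases p <;> fin_cases q
  · exact h0
  · exact h1
  · exact h2
  · have := sl_trace x
    have := sl_trace y
    simp_all

theorem symProd_00 (c : Fin 2 → Fin 2 → K) : (symProd c).1 0 0 = -(c 0 1 + c 1 0) := by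
  simp [symProd, psi, Fin.sum_univ_two]; ring

theorem symProd_01 (c : Fin 2 → Fin 2 → K) : (symProd c).1 0 1 = 2 * c 0 0 := by
  simp [symProd, psi, Fin.sum_univ_two]; ring

theorem symProd_10 (c : Fin 2 → Fin 2 → K) : (symProd c).1 1 0 = -(2 * c 1 1) := by
  simp [symProd, psi, Fin.sum_univ_two]; ring

theorem psi_contract (f : Fin 2 → Fin 2 → Fin 2 → Fin 2 → K) :
    ∑ q, ∑ q', ∑ r, ∑ r', psi K q q' * psi K r r' * f q q' r r' =
      f 0 1 0 1 - f 0 1 1 0 - f 1 0 0 1 + f 1 0 1 0 := by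
  simp [psi, Fin.sum_univ_two]; ring

theorem oddBracket_zero (a : K) (v w : Odd K) : oddBracket a v w 0 =
    sigma a 0 • symProd fun i j => v i 0 0 * w j 1 1 - v i 0 1 * w j 1 0 - v i 1 0 * w j 0 1
      + v i 1 1 * w j 0 0 := by
  simp only [oddBracket, Matrix.cons_val]
  congr 2
  funext i j
  exact psi_contract fun q q' r r' => v i q r * w j q' r'

theorem oddBracket_one (a : K) (v w : Odd K) : oddBracket a v w 1 =
    sigma a 1 • symProd fun i j => v 0 i 0 * w 1 j 1 - v 0 i 1 * w 1 j 0 - v 1 i 0 * w 0 j 1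
      + v 1 i 1 * w 0 j 0 := by
  simp only [oddBracket, Matrix.cons_val]
  congr 2
  funext i j
  exact psi_contract fun p p' r r' => v p i r * w p' j r'

theorem oddBracket_two (a : K) (v w : Odd K) : oddBracket a v w 2 =
    sigma a 2 • symProd fun i j => v 0 0 i * w 1 1 j - v 0 1 i * w 1 0 j - v 1 0 i * w 0 1 j
      + v 1 1 i * w 0 0 j := by
  simp only [oddBracket, Matrix.cons_val]
  congr 2
  funext i j
  exact psi_contract fun p p' q q' => v p q i * w p' q' j

theorem sl_lie_apply (x y : LieAlgebra.SpecialLinear.sl (Fin 2) K) (p q : Fin 2) :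
    (⁅x, y⁆ : LieAlgebra.SpecialLinear.sl (Fin 2) K).1 p q =
      x.1 p 0 * y.1 0 q + x.1 p 1 * y.1 1 q - (y.1 p 0 * x.1 0 q + y.1 p 1 * x.1 1 q) := by
  rw [LieAlgebra.SpecialLinear.sl_bracket]
  simp [Matrix.mul_apply, Fin.sum_univ_two]

theorem sl_smul_apply (c : K) (x : LieAlgebra.SpecialLinear.sl (Fin 2) K) (p q : Fin 2) :
    (c • x).1 p q = c * x.1 p q := rfl

theorem sl_add_apply (x y : LieAlgebra.SpecialLinear.sl (Fin 2) K) (p q : Fin 2) :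
    (x + y).1 p q = x.1 p q + y.1 p q := rfl

theorem act_lie (x y : Fin 3 → LieAlgebra.SpecialLinear.sl (Fin 2) K) (w : Odd K) :
    act (evenBracket x y) w = act x (act y w) - act y (act x w) := by
  funext p q r
  simp only [act, evenBracket, sl_lie_apply, Pi.sub_apply, Fin.sum_univ_two]
  ring

theorem oddBracket_comm (a : K) (v w : Odd K) : oddBracket a v w = oddBracket a w v := by
  funext i
  fin_cases i
  · change oddBracket a v w 0 = oddBracket a w v 0
    simp only [oddBracket_zero]
    apply sl_ext <;> simp only [sl_smul_apply, symProd_00, symProd_01, symProd_10] <;> ring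
  · change oddBracket a v w 1 = oddBracket a w v 1
    simp only [oddBracket_one]
    apply sl_ext <;> simp only [sl_smul_apply, symProd_00, symProd_01, symProd_10] <;> ring
  · change oddBracket a v w 2 = oddBracket a w v 2
    simp only [oddBracket_two]
    apply sl_ext <;> simp only [sl_smul_apply, symProd_00, symProd_01, symProd_10] <;> ring

theorem lie_oddBracket (a : K) (x : Fin 3 → LieAlgebra.SpecialLinear.sl (Fin 2) K)
    (v w : Odd K) :
    evenBracket x (oddBracket a v w) = oddBracket a (act x v) w + oddBracket a v (act x w) := by
  funext i
  fin_cases i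
  · change ⁅x 0, oddBracket a v w 0⁆ = oddBracket a (act x v) w 0 + oddBracket a v (act x w) 0
    simp only [oddBracket_zero]
    apply sl_ext <;> simp only [sl_smul_apply, symProd_00, symProd_01, symProd_10, sl_lie_apply,
      sl_trace, sl_add_apply, act, Fin.sum_univ_two] <;> ring
  · change ⁅x 1, oddBracket a v w 1⁆ = oddBracket a (act x v) w 1 + oddBracket a v (act x w) 1
    simp only [oddBracket_one]
    apply sl_ext <;> simp only [sl_smul_apply, symProd_00, symProd_01, symProd_10, sl_lie_apply,
      sl_trace, sl_add_apply, act, Fin.sum_univ_two] <;> ring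
  · change ⁅x 2, oddBracket a v w 2⁆ = oddBracket a (act x v) w 2 + oddBracket a v (act x w) 2
    simp only [oddBracket_two]
    apply sl_ext <;> simp only [sl_smul_apply, symProd_00, symProd_01, symProd_10, sl_lie_apply,
      sl_trace, sl_add_apply, act, Fin.sum_univ_two] <;> ring

theorem act_oddBracket (a : K) (h2 : (2 : K) ≠ 0) (u v w : Odd K) :
    act (oddBracket a u v) w + act (oddBracket a v w) u + act (oddBracket a w u) v = 0 := by
  have h0 : sigma a 0 = - sigma a 1 - sigma a 2 := by
    simp [sigma]; field_simp; ring
  funext p q r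
  simp only [act, oddBracket_zero, oddBracket_one, oddBracket_two, Fin.sum_univ_two,
    Pi.add_apply, Pi.zero_apply, sl_smul_apply, h0]
  fin_cases p <;> fin_cases q <;> fin_cases r <;>
    simp only [Fin.zero_eta, Fin.mk_one, symProd_00, symProd_01, symProd_10, sl_trace] <;> ring

theorem act_add (x y : Fin 3 → LieAlgebra.SpecialLinear.sl (Fin 2) K) (w : Odd K) :
    act (x + y) w = act x w + act y w := by
  funext p q r
  simp only [act, Pi.add_apply, sl_add_apply, Fin.sum_univ_two]
  ring

theorem act_smul (c : K) (x : Fin 3 → LieAlgebra.SpecialLinear.sl (Fin 2) K) (w : Odd K) :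
    act (c • x) w = c • act x w := by
  funext p q r
  simp only [act, Pi.smul_apply, sl_smul_apply, Fin.sum_univ_two, smul_eq_mul]
  ring

theorem act_add' (x : Fin 3 → LieAlgebra.SpecialLinear.sl (Fin 2) K) (v w : Odd K) :
    act x (v + w) = act x v + act x w := by
  funext p q r
  simp only [act, Pi.add_apply, Fin.sum_univ_two]
  ring

theorem act_smul' (c : K) (x : Fin 3 → LieAlgebra.SpecialLinear.sl (Fin 2) K) (w : Odd K) :
    act x (c • w) = c • act x w := by
  funext p q r
  simp only [act, Pi.smul_apply, Fin.sum_univ_two, smul_eq_mul]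
  ring

theorem oddBracket_add (a : K) (u v w : Odd K) :
    oddBracket a (u + v) w = oddBracket a u w + oddBracket a v w := by
  funext i
  fin_cases i
  · change oddBracket a (u + v) w 0 = oddBracket a u w 0 + oddBracket a v w 0
    simp only [oddBracket_zero]
    apply sl_ext <;> simp only [sl_smul_apply, symProd_00, symProd_01, symProd_10,
      sl_add_apply, Pi.add_apply] <;> ring
  · change oddBracket a (u + v) w 1 = oddBracket a u w 1 + oddBracket a v w 1
    simp only [oddBracket_one]
    apply sl_ext <;> simp only [sl_smul_apply, symProd_00, symProd_01, symProd_10,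
      sl_add_apply, Pi.add_apply] <;> ring
  · change oddBracket a (u + v) w 2 = oddBracket a u w 2 + oddBracket a v w 2
    simp only [oddBracket_two]
    apply sl_ext <;> simp only [sl_smul_apply, symProd_00, symProd_01, symProd_10,
      sl_add_apply, Pi.add_apply] <;> ring

theorem oddBracket_smul (a c : K) (v w : Odd K) :
    oddBracket a (c • v) w = c • oddBracket a v w := by
  funext i
  fin_cases i
  · change oddBracket a (c • v) w 0 = c • oddBracket a v w 0
    simp only [oddBracket_zero]
    apply sl_ext <;> simp only [sl_smul_apply, symProd_00, symProd_01, symProd_10,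
      Pi.smul_apply, smul_eq_mul] <;> ring
  · change oddBracket a (c • v) w 1 = c • oddBracket a v w 1
    simp only [oddBracket_one]
    apply sl_ext <;> simp only [sl_smul_apply, symProd_00, symProd_01, symProd_10,
      Pi.smul_apply, smul_eq_mul] <;> ring
  · change oddBracket a (c • v) w 2 = c • oddBracket a v w 2
    simp only [oddBracket_two]
    apply sl_ext <;> simp only [sl_smul_apply, symProd_00, symProd_01, symProd_10,
      Pi.smul_apply, smul_eq_mul] <;> ring

theorem evenBracket_self_jacobi (x y z : Fin 3 → LieAlgebra.SpecialLinear.sl (Fin 2) K) :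
    evenBracket x (evenBracket y z) + evenBracket y (evenBracket z x)
      + evenBracket z (evenBracket x y) = 0 :=
  funext fun i => lie_jacobi (x i) (y i) (z i)

/-- The bracket `[(x, v), (y, w)] = ([x, y] + [v, w], x . w - y . v)`. -/
def bracket (a : K) : Carrier K →ₗ[K] Carrier K →ₗ[K] Carrier K :=
  LinearMap.mk₂ K
    (fun x y => (evenBracket x.1 y.1 + oddBracket a x.2 y.2, act x.1 y.2 - act y.1 x.2))
    (by
      intro x y z
      refine Prod.ext ?_ ?_
      · have h : evenBracket (x.1 + y.1) z.1 = evenBracket x.1 z.1 + evenBracket y.1 z.1 :=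
          funext fun i => add_lie _ _ _
        simp only [Prod.fst_add, Prod.snd_add, h, oddBracket_add]
        abel
      · simp only [Prod.fst_add, Prod.snd_add, act_add, act_add']
        abel)
    (by
      intro c x z
      refine Prod.ext ?_ ?_
      · have h : evenBracket (c • x.1) z.1 = c • evenBracket x.1 z.1 :=
          funext fun i => smul_lie c (x.1 i) (z.1 i)
        simp only [Prod.smul_fst, Prod.smul_snd, h, oddBracket_smul, smul_add]
      · simp only [Prod.smul_fst, Prod.smul_snd, act_smul, act_smul', smul_sub])
    (by
      intro x y z
      refine Prod.ext ?_ ?_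
      · have h : evenBracket x.1 (y.1 + z.1) = evenBracket x.1 y.1 + evenBracket x.1 z.1 :=
          funext fun i => lie_add _ _ _
        simp only [Prod.fst_add, Prod.snd_add, h, oddBracket_comm a x.2, oddBracket_add]
        abel
      · simp only [Prod.fst_add, Prod.snd_add, act_add, act_add']
        abel)
    (by
      intro c x z
      refine Prod.ext ?_ ?_
      · have h : evenBracket x.1 (c • z.1) = c • evenBracket x.1 z.1 :=
          funext fun i => lie_smul c (x.1 i) (z.1 i)
        simp only [Prod.smul_fst, Prod.smul_snd, h, oddBracket_comm a x.2, oddBracket_smul,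
          smul_add]
      · simp only [Prod.smul_fst, Prod.smul_snd, act_smul, act_smul', smul_sub])

theorem bracket_apply (a : K) (x y : Carrier K) : bracket a x y =
    (evenBracket x.1 y.1 + oddBracket a x.2 y.2, act x.1 y.2 - act y.1 x.2) := rfl

/-- The even part is `sl₂ ⊕ sl₂ ⊕ sl₂`, the odd part is `K² ⊗ K² ⊗ K²`. -/
def part (K : Type*) [Field K] (i : ZMod 2) : Submodule K (Carrier K) :=
  if i = 0 then LinearMap.ker (LinearMap.snd K _ _) else LinearMap.ker (LinearMap.fst K _ _)

theorem mem_part_zero {x : Carrier K} : x ∈ part K 0 ↔ x.2 = 0 := by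
  simp [part]

theorem mem_part_one {x : Carrier K} : x ∈ part K 1 ↔ x.1 = 0 := by
  simp [part]

theorem act_zero_left (w : Odd K) : act 0 w = 0 := by
  simpa using act_smul (0 : K) 0 w

theorem act_zero_right (x : Fin 3 → LieAlgebra.SpecialLinear.sl (Fin 2) K) :
    act x 0 = 0 := by
  simpa using act_smul' (0 : K) x 0

theorem oddBracket_zero_left (a : K) (w : Odd K) : oddBracket a 0 w = 0 := by
  simpa using oddBracket_smul a 0 0 w

theorem oddBracket_zero_right (a : K) (w : Odd K) : oddBracket a w 0 = 0 := by
  rw [oddBracket_comm, oddBracket_zero_left]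

theorem act_neg (x : Fin 3 → LieAlgebra.SpecialLinear.sl (Fin 2) K) (w : Odd K) :
    act x (-w) = -act x w := by
  simpa using act_smul' (-1 : K) x w

theorem oddBracket_neg_left (a : K) (v w : Odd K) :
    oddBracket a (-v) w = -oddBracket a v w := by
  simpa using oddBracket_smul a (-1) v w

theorem oddBracket_neg_right (a : K) (v w : Odd K) :
    oddBracket a v (-w) = -oddBracket a v w := by
  rw [oddBracket_comm, oddBracket_neg_left, oddBracket_comm]

theorem evenBracket_zero_left (x : Fin 3 → LieAlgebra.SpecialLinear.sl (Fin 2) K) :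
    evenBracket 0 x = 0 := funext fun i => zero_lie (x i)

theorem evenBracket_zero_right (x : Fin 3 → LieAlgebra.SpecialLinear.sl (Fin 2) K) :
    evenBracket x 0 = 0 := funext fun i => lie_zero (x i)

theorem evenBracket_skew (x y : Fin 3 → LieAlgebra.SpecialLinear.sl (Fin 2) K) :
    evenBracket x y + evenBracket y x = 0 := by
  funext i
  change ⁅x i, y i⁆ + ⁅y i, x i⁆ = 0
  rw [← lie_skew, neg_add_cancel]

theorem parity_cases (i : ZMod 2) : i = 0 ∨ i = 1 := by
  revert i; decide

/-- The Lie superalgebra `D(2,1;a)` over `K`. -/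
def algebra [CharZero K] (a : K) : LieSuperalgebra K (Carrier K) where
  part := part K
  isCompl := by
    constructor
    · rw [Submodule.disjoint_def]
      intro x h0 h1
      exact Prod.ext (mem_part_one.1 h1) (mem_part_zero.1 h0)
    · rw [codisjoint_iff, Submodule.eq_top_iff']
      intro x
      rw [Submodule.mem_sup]
      exact ⟨(x.1, 0), mem_part_zero.2 rfl, (0, x.2), mem_part_one.2 rfl, by simp⟩
  bracket := bracket a
  bracket_mem := by
    intro i j x hx y hy
    rcases parity_cases i with rfl | rfl <;> rcases parity_cases j with rfl | rfl
    · rw [show (0 + 0 : ZMod 2) = 0 from rfl]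
      rw [mem_part_zero] at *
      simp [bracket_apply, hx, hy, act_zero_right]
    · rw [show (0 + 1 : ZMod 2) = 1 from rfl]
      rw [mem_part_zero] at hx
      rw [mem_part_one] at *
      simp [bracket_apply, hx, hy, oddBracket_zero_left, evenBracket_zero_right]
    · rw [show (1 + 0 : ZMod 2) = 1 from rfl]
      rw [mem_part_zero] at hy
      rw [mem_part_one] at *
      simp [bracket_apply, hx, hy, oddBracket_zero_right, evenBracket_zero_left]
    · rw [show (1 + 1 : ZMod 2) = 0 from rfl]
      rw [mem_part_one] at hx hy
      rw [mem_part_zero]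
      simp [bracket_apply, hx, hy, act_zero_left]
  skew := by
    intro i j x hx y hy
    obtain ⟨x0, x1⟩ := x
    obtain ⟨y0, y1⟩ := y
    rcases parity_cases i with rfl | rfl <;> rcases parity_cases j with rfl | rfl <;>
      simp only [mem_part_zero, mem_part_one] at hx hy <;> subst hx <;> subst hy <;>
      simp [bracket_apply, superSign, evenBracket_skew, act_zero_right, act_zero_left,
        oddBracket_zero_left, oddBracket_zero_right, evenBracket_zero_right,
        evenBracket_zero_left]
    rw [oddBracket_comm, add_neg_cancel]
  jacobi := by
    have h2 : (2 : K) ≠ 0 := two_ne_zero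
    intro i j k x hx y hy z hz
    obtain ⟨x0, x1⟩ := x
    obtain ⟨y0, y1⟩ := y
    obtain ⟨z0, z1⟩ := z
    rcases parity_cases i with rfl | rfl <;> rcases parity_cases j with rfl | rfl <;>
      rcases parity_cases k with rfl | rfl <;>
      simp only [mem_part_zero, mem_part_one] at hx hy hz <;> subst hx <;> subst hy <;>
      subst hz <;>
      simp only [bracket_apply, superSign, act_zero_right, act_zero_left, oddBracket_zero_left,
        oddBracket_zero_right, evenBracket_zero_right, evenBracket_zero_left, zero_ne_one,
        and_false, and_self, if_true, if_false, one_smul, add_zero, zero_add,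
        sub_zero, zero_sub, Prod.mk_add_mk, neg_smul, Prod.mk_eq_zero, sub_self, and_true,
        true_and, act_neg, oddBracket_neg_right, Prod.neg_mk, act_lie,
        lie_oddBracket, neg_neg, neg_zero]
    · exact evenBracket_self_jacobi _ _ _
    · abel
    · abel
    · rw [oddBracket_comm a z1 (act x0 y1), oddBracket_comm a y1 (act x0 z1)]
      abel
    · abel
    · rw [oddBracket_comm a x1 (act y0 z1), oddBracket_comm a z1 (act y0 x1)]
      abel
    · rw [oddBracket_comm a y1 (act z0 x1), oddBracket_comm a x1 (act z0 y1)]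
      abel
    · rw [← act_oddBracket a h2 x1 y1 z1]
      abel

/-- The element `e` of the standard `sl₂`-triple. -/
def slE (K : Type*) [Field K] : LieAlgebra.SpecialLinear.sl (Fin 2) K :=
  ⟨!![0, 1; 0, 0], by
    change Matrix.trace (n := Fin 2) (R := K) _ = 0
    simp [Matrix.trace, Fin.sum_univ_two]⟩

/-- The element `f` of the standard `sl₂`-triple. -/
def slF (K : Type*) [Field K] : LieAlgebra.SpecialLinear.sl (Fin 2) K :=
  ⟨!![0, 0; 1, 0], by
    change Matrix.trace (n := Fin 2) (R := K) _ = 0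
    simp [Matrix.trace, Fin.sum_univ_two]⟩

/-- The element `h` of the standard `sl₂`-triple. -/
def slH (K : Type*) [Field K] : LieAlgebra.SpecialLinear.sl (Fin 2) K :=
  ⟨!![1, 0; 0, -1], by
    change Matrix.trace (n := Fin 2) (R := K) _ = 0
    simp [Matrix.trace, Fin.sum_univ_two]⟩

/-- The even element `x` in the `i`-th copy of `sl₂`. -/
def inEven (i : Fin 3) (x : LieAlgebra.SpecialLinear.sl (Fin 2) K) : Carrier K :=
  (Pi.single i x, 0)

/-- The odd basis vector `e_p ⊗ e_q ⊗ e_r`. -/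
def inOdd (K : Type*) [Field K] (p q r : Fin 2) : Carrier K :=
  (0, fun i j k => if i = p ∧ j = q ∧ k = r then 1 else 0)

/-- The Chevalley generators `h₁, h₂, h₃`. -/
def genH (a : K) : Fin 3 → Carrier K :=
  ![(1 / 2 : K) • ((1 + a) • inEven 0 (slH K) + inEven 1 (slH K) + a • inEven 2 (slH K)),
    inEven 1 (slH K), inEven 2 (slH K)]

/-- The Chevalley generators `e₁, e₂, e₃`. -/
def genE (K : Type*) [Field K] : Fin 3 → Carrier K :=
  ![inOdd K 0 1 1, inEven 1 (slE K), inEven 2 (slE K)]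

/-- The Chevalley generators `f₁, f₂, f₃`. -/
def genF (K : Type*) [Field K] : Fin 3 → Carrier K :=
  ![inOdd K 1 0 0, inEven 1 (slF K), inEven 2 (slF K)]

/-- The Cartan matrix. -/
def cartanMatrix (a : K) : Matrix (Fin 3) (Fin 3) K := !![0, 1, a; -1, 2, 0; -1, 0, 2]

theorem carrier_ext {x y : Carrier K} (h : ∀ i p q, (x.1 i).1 p q = (y.1 i).1 p q)
    (h' : ∀ p q r, x.2 p q r = y.2 p q r) : x = y :=
  Prod.ext (funext fun i => Subtype.ext (Matrix.ext (h i)))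
    (funext fun p => funext fun q => funext fun r => h' p q r)

theorem bracket_even (a : K) (i j : Fin 3) (x y : LieAlgebra.SpecialLinear.sl (Fin 2) K) :
    bracket a (inEven i x) (inEven j y) = if i = j then inEven i ⁅x, y⁆ else 0 := by
  refine Prod.ext ?_ ?_
  · funext k
    simp only [bracket_apply, inEven, oddBracket_zero_left, add_zero]
    change ⁅(Pi.single i x : Fin 3 → LieAlgebra.SpecialLinear.sl (Fin 2) K) k,
      (Pi.single j y : Fin 3 → LieAlgebra.SpecialLinear.sl (Fin 2) K) k⁆ = _
    by_cases h : i = j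
    · subst h
      rw [if_pos rfl]
      by_cases hk : k = i
      · subst hk; simp
      · simp [hk]
    · rw [if_neg h]
      by_cases hk : k = i
      · subst hk; simp [h]
      · simp [hk]
  · split_ifs <;> simp [bracket_apply, inEven, act_zero_right]

theorem inEven_smul (i : Fin 3) (c : K) (x : LieAlgebra.SpecialLinear.sl (Fin 2) K) :
    inEven i (c • x) = c • inEven i x := by
  simp [inEven, Pi.single_smul]

theorem inEven_neg (i : Fin 3) (x : LieAlgebra.SpecialLinear.sl (Fin 2) K) :
    inEven i (-x) = -inEven i x := by
  simp [inEven, Pi.single_neg]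

theorem slH_E : ⁅slH K, slE K⁆ = (2 : K) • slE K := by
  apply sl_ext <;> simp [sl_lie_apply, slH, slE]
  norm_num

theorem slH_F : ⁅slH K, slF K⁆ = -((2 : K) • slF K) := by
  rw [← neg_smul]
  apply sl_ext <;> simp [sl_lie_apply, slH, slF]
  norm_num

theorem slE_F : ⁅slE K, slF K⁆ = slH K := by
  apply sl_ext <;> simp [sl_lie_apply, slH, slE, slF]

theorem bracket_even_vec_zero (a : K) (x : LieAlgebra.SpecialLinear.sl (Fin 2) K) (v : Odd K) :
    bracket a (inEven 0 x) (0, v) =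
      (0, fun p q r => x.1 p 0 * v 0 q r + x.1 p 1 * v 1 q r) := by
  refine Prod.ext ?_ ?_
  · simp [bracket_apply, inEven, evenBracket_zero_right, oddBracket_zero_left]
  · funext i j k
    simp [bracket_apply, inEven, act]

theorem bracket_even_vec_one (a : K) (x : LieAlgebra.SpecialLinear.sl (Fin 2) K) (v : Odd K) :
    bracket a (inEven 1 x) (0, v) =
      (0, fun p q r => x.1 q 0 * v p 0 r + x.1 q 1 * v p 1 r) := by
  refine Prod.ext ?_ ?_
  · simp [bracket_apply, inEven, evenBracket_zero_right, oddBracket_zero_left]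
  · funext i j k
    simp [bracket_apply, inEven, act]

theorem bracket_even_vec_two (a : K) (x : LieAlgebra.SpecialLinear.sl (Fin 2) K) (v : Odd K) :
    bracket a (inEven 2 x) (0, v) =
      (0, fun p q r => x.1 r 0 * v p q 0 + x.1 r 1 * v p q 1) := by
  refine Prod.ext ?_ ?_
  · simp [bracket_apply, inEven, evenBracket_zero_right, oddBracket_zero_left]
  · funext i j k
    simp [bracket_apply, inEven, act]

theorem bracket_even_odd_zero (a : K) (x : LieAlgebra.SpecialLinear.sl (Fin 2) K)
    (p q r : Fin 2) : bracket a (inEven 0 x) (inOdd K p q r) =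
      x.1 0 p • inOdd K 0 q r + x.1 1 p • inOdd K 1 q r := by
  refine (bracket_even_vec_zero a x _).trans (Prod.ext (by simp [inOdd]) ?_)
  funext i j k
  fin_cases p <;> fin_cases i <;> simp [inOdd]

theorem bracket_even_odd_one (a : K) (x : LieAlgebra.SpecialLinear.sl (Fin 2) K)
    (p q r : Fin 2) : bracket a (inEven 1 x) (inOdd K p q r) =
      x.1 0 q • inOdd K p 0 r + x.1 1 q • inOdd K p 1 r := by
  refine (bracket_even_vec_one a x _).trans (Prod.ext (by simp [inOdd]) ?_)
  funext i j k
  fin_cases q <;> fin_cases j <;> simp [inOdd]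

theorem bracket_even_odd_two (a : K) (x : LieAlgebra.SpecialLinear.sl (Fin 2) K)
    (p q r : Fin 2) : bracket a (inEven 2 x) (inOdd K p q r) =
      x.1 0 r • inOdd K p q 0 + x.1 1 r • inOdd K p q 1 := by
  refine (bracket_even_vec_two a x _).trans (Prod.ext (by simp [inOdd]) ?_)
  funext i j k
  fin_cases r <;> fin_cases k <;> simp [inOdd]

theorem bracket_odd_even (a : K) (i : Fin 3) (x : LieAlgebra.SpecialLinear.sl (Fin 2) K)
    (p q r : Fin 2) : bracket a (inOdd K p q r) (inEven i x) =
      -bracket a (inEven i x) (inOdd K p q r) := by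
  simp [bracket_apply, inEven, inOdd, evenBracket_zero_right, evenBracket_zero_left,
    oddBracket_zero_left, oddBracket_zero_right, act_zero_left]

theorem bracket_odd (a : K) (p q r p' q' r' : Fin 2) :
    bracket a (inOdd K p q r) (inOdd K p' q' r') =
      inEven 0 ((sigma a 0 * psi K q q' * psi K r r') •
          symProd (fun i j => if i = p ∧ j = p' then 1 else 0))
      + inEven 1 ((sigma a 1 * psi K p p' * psi K r r') •
          symProd (fun i j => if i = q ∧ j = q' then 1 else 0))
      + inEven 2 ((sigma a 2 * psi K p p' * psi K q q') •
          symProd (fun i j => if i = r ∧ j = r' then 1 else 0)) := by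
  have key : ∀ (c d : K) (f g : Fin 2 → Fin 2 → K), (∀ i j, f i j = d * g i j) →
      c • symProd f = (c * d) • symProd g := by
    intro c d f g h
    apply sl_ext <;> simp only [sl_smul_apply, symProd_00, symProd_01, symProd_10, h] <;> ring
  refine Prod.ext ?_ ?_
  · funext k
    fin_cases k
    · simp only [bracket_apply, inEven, inOdd, evenBracket_zero_left, zero_add,
        Fin.zero_eta, Prod.fst_add, Pi.add_apply, Pi.single_eq_same]
      rw [oddBracket_zero, mul_assoc (sigma a 0), Pi.single_eq_of_ne (by decide),
        Pi.single_eq_of_ne (by decide), add_zero, add_zero]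
      apply key
      intro i j
      fin_cases q <;> fin_cases q' <;> fin_cases r <;> fin_cases r' <;> simp [psi, ite_and] <;>
        split_ifs <;> simp
    · simp only [bracket_apply, inEven, inOdd, evenBracket_zero_left, zero_add,
        Fin.mk_one, Prod.fst_add, Pi.add_apply, Pi.single_eq_same]
      rw [oddBracket_one, mul_assoc (sigma a 1), Pi.single_eq_of_ne (by decide),
        Pi.single_eq_of_ne (by decide), add_zero, zero_add]
      apply key
      intro i j
      fin_cases p <;> fin_cases p' <;> fin_cases r <;> fin_cases r' <;> simp [psi, ite_and] <;>
        split_ifs <;> simp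
    · simp only [bracket_apply, inEven, inOdd, evenBracket_zero_left, zero_add,
        Fin.reduceFinMk, Prod.fst_add, Pi.add_apply, Pi.single_eq_same]
      rw [oddBracket_two, mul_assoc (sigma a 2), Pi.single_eq_of_ne (by decide),
        Pi.single_eq_of_ne (by decide), zero_add, zero_add]
      apply key
      intro i j
      fin_cases p <;> fin_cases p' <;> fin_cases q <;> fin_cases q' <;> simp [psi, ite_and] <;>
        split_ifs <;> simp
  · simp [bracket_apply, inEven, inOdd, act_zero_left]


theorem symProd_h : symProd (fun i j : Fin 2 => if i = 0 ∧ j = 1 then (1 : K) else 0) = -slH K ∧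
    symProd (fun i j : Fin 2 => if i = 1 ∧ j = 0 then (1 : K) else 0) = -slH K := by
  constructor <;> rw [← neg_one_smul K] <;> apply sl_ext <;>
    simp [symProd_00, symProd_01, symProd_10, slH]

theorem symProd_e : symProd (fun i j : Fin 2 => if i = 0 ∧ j = 0 then (1 : K) else 0) =
    (2 : K) • slE K := by
  apply sl_ext <;> simp [symProd_00, symProd_01, symProd_10, slE]

theorem symProd_f : symProd (fun i j : Fin 2 => if i = 1 ∧ j = 1 then (1 : K) else 0) =
    -((2 : K) • slF K) := by
  rw [← neg_smul]
  apply sl_ext <;> simp [symProd_00, symProd_01, symProd_10, slF]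

set_option maxHeartbeats 1000000 in
/-- The defining relations of the contragredient Lie superalgebra with the Cartan matrix above. -/
theorem gen_relations [CharZero K] (a : K) (i j : Fin 3) :
    bracket a (genH a i) (genH a j) = 0 ∧
    bracket a (genH a i) (genE K j) = cartanMatrix a i j • genE K j ∧
    bracket a (genH a i) (genF K j) = -(cartanMatrix a i j • genF K j) ∧
    bracket a (genE K i) (genF K j) = (if i = j then genH a i else 0) ∧
    bracket a (genE K 0) (genE K 0) = 0 ∧ bracket a (genF K 0) (genF K 0) = 0 := by
  have h2 : (2 : K) ≠ 0 := two_ne_zero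
  refine ⟨?_, ?_, ?_, ?_, ?_, ?_⟩
  · fin_cases i <;> fin_cases j <;> simp [genH, bracket_even] <;> simp [inEven]
  · fin_cases i <;> fin_cases j <;>
      simp [genH, genE, cartanMatrix, bracket_even, bracket_even_odd_zero, bracket_even_odd_one,
        bracket_even_odd_two, slH_E, inEven_smul] <;> try simp [slH]
    all_goals try module
  · fin_cases i <;> fin_cases j <;>
      simp [genH, genF, cartanMatrix, bracket_even, bracket_even_odd_zero, bracket_even_odd_one,
        bracket_even_odd_two, slH_F, inEven_neg, inEven_smul] <;> try simp [slH]
    all_goals try module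
  · fin_cases i <;> fin_cases j <;>
      simp [genH, genF, genE, bracket_even, bracket_even_odd_one, bracket_even_odd_two, slE_F,
        bracket_odd_even, bracket_odd]
    · simp only [psi, symProd_h, sigma, inEven_smul, inEven_neg, smul_neg, Matrix.cons_val]
      simp
      module
    all_goals simp [slE, slF]
  · simp [genE, bracket_odd, psi, inEven]
  · simp [genF, bracket_odd, psi, inEven]


theorem mem_of_basis (S : Submodule K (Carrier K)) (hE : ∀ i, inEven i (slE K) ∈ S)
    (hF : ∀ i, inEven i (slF K) ∈ S) (hH : ∀ i, inEven i (slH K) ∈ S)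
    (hO : ∀ p q r, inOdd K p q r ∈ S) (x : Carrier K) : x ∈ S := by
  have h : x = ∑ i, ((x.1 i).1 0 1 • inEven i (slE K) + (x.1 i).1 1 0 • inEven i (slF K)
      + (x.1 i).1 0 0 • inEven i (slH K)) + ∑ p, ∑ q, ∑ r, x.2 p q r • inOdd K p q r := by
    refine Prod.ext ?_ ?_
    · have hx : ∀ y : LieAlgebra.SpecialLinear.sl (Fin 2) K,
          y.1 0 1 • slE K + y.1 1 0 • slF K + y.1 0 0 • slH K = y := by
        intro y
        apply sl_ext <;> simp [slE, slF, slH]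
      funext i
      conv_lhs => rw [← hx (x.1 i)]
      fin_cases i <;> simp [Fin.sum_univ_three, inEven, inOdd]
    · funext p q r
      fin_cases p <;> fin_cases q <;> fin_cases r <;>
        simp [Fin.sum_univ_three, inEven, inOdd]
  rw [h]
  refine S.add_mem (S.sum_mem fun i _ => S.add_mem (S.add_mem (S.smul_mem _ (hE i))
    (S.smul_mem _ (hF i))) (S.smul_mem _ (hH i))) ?_
  exact S.sum_mem fun p _ => S.sum_mem fun q _ => S.sum_mem fun r _ => S.smul_mem _ (hO p q r)

/-- `D(2,1;a)` is generated by the Chevalley generators. -/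
theorem gen_generate [CharZero K] {a : K} (ha : a ≠ -1) (S : Submodule K (Carrier K))
    (hS : ∀ x ∈ S, ∀ y ∈ S, bracket a x y ∈ S) (hE : ∀ i, genE K i ∈ S)
    (hF : ∀ i, genF K i ∈ S) : S = ⊤ := by
  have h2 : (2 : K) ≠ 0 := two_ne_zero
  have ha1 : 1 + a ≠ 0 := fun h => ha (by linear_combination h)
  have e1 : inOdd K 0 1 1 ∈ S := hE 0
  have e2 : inEven 1 (slE K) ∈ S := hE 1
  have e3 : inEven 2 (slE K) ∈ S := hE 2
  have f1 : inOdd K 1 0 0 ∈ S := hF 0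
  have f2 : inEven 1 (slF K) ∈ S := hF 1
  have f3 : inEven 2 (slF K) ∈ S := hF 2
  have o001 : inOdd K 0 0 1 ∈ S := by
    simpa [bracket_even_odd_one, slE] using hS _ e2 _ e1
  have o010 : inOdd K 0 1 0 ∈ S := by
    simpa [bracket_even_odd_two, slE] using hS _ e3 _ e1
  have o000 : inOdd K 0 0 0 ∈ S := by
    simpa [bracket_even_odd_one, slE] using hS _ e2 _ o010
  have o110 : inOdd K 1 1 0 ∈ S := by
    simpa [bracket_even_odd_one, slF] using hS _ f2 _ f1
  have o101 : inOdd K 1 0 1 ∈ S := by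
    simpa [bracket_even_odd_two, slF] using hS _ f3 _ f1
  have o111 : inOdd K 1 1 1 ∈ S := by
    simpa [bracket_even_odd_one, slF] using hS _ f2 _ o101
  have e0 : inEven 0 (slE K) ∈ S := by
    have h := hS _ o000 _ e1
    rw [bracket_odd, symProd_e] at h
    rw [← S.smul_mem_iff (neg_ne_zero.2 ha1)]
    convert h using 1
    simp [psi, sigma, inEven, smul_smul, ← Pi.single_smul]
  have f0 : inEven 0 (slF K) ∈ S := by
    have h := hS _ o111 _ f1
    rw [bracket_odd, symProd_f] at h
    rw [← S.smul_mem_iff ha1]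
    convert h using 1
    simp [psi, sigma, inEven, smul_smul, ← Pi.single_smul, ← neg_smul]
  have hEE : ∀ i, inEven i (slE K) ∈ S := by
    intro i
    fin_cases i
    exacts [e0, e2, e3]
  have hFF : ∀ i, inEven i (slF K) ∈ S := by
    intro i
    fin_cases i
    exacts [f0, f2, f3]
  rw [Submodule.eq_top_iff']
  refine mem_of_basis S hEE hFF (fun i => ?_) (fun p q r => ?_)
  · simpa [bracket_even, slE_F] using hS _ (hEE i) _ (hFF i)
  · fin_cases p <;> fin_cases q <;> fin_cases r <;> assumption

/-- The Cartan subalgebra `h`, spanned by the diagonal elements of the three copies of `sl₂`. -/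
def cartan (K : Type*) [Field K] : Submodule K (Carrier K) :=
  Submodule.span K (Set.range fun i => inEven i (slH K))

/-- `h` is spanned by `h₁, h₂, h₃`. -/
theorem cartan_eq [CharZero K] {a : K} (ha : a ≠ -1) :
    cartan K = Submodule.span K (Set.range (genH a)) := by
  have ha1 : 1 + a ≠ 0 := fun h => ha (by linear_combination h)
  have m : ∀ i, inEven i (slH K) ∈ cartan K := fun i => Submodule.subset_span ⟨i, rfl⟩
  apply le_antisymm
  · rw [cartan, Submodule.span_le]
    have n : ∀ i, genH a i ∈ Submodule.span K (Set.range (genH a)) :=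
      fun i => Submodule.subset_span ⟨i, rfl⟩
    have n1 : inEven 1 (slH K) ∈ Submodule.span K (Set.range (genH a)) := n 1
    have n2 : inEven 2 (slH K) ∈ Submodule.span K (Set.range (genH a)) := n 2
    rintro _ ⟨i, rfl⟩
    fin_cases i
    · have h := Submodule.sub_mem _ (Submodule.sub_mem _ (Submodule.smul_mem _ (2 : K) (n 0)) n1)
        (Submodule.smul_mem _ a n2)
      have h' : (1 + a) • inEven 0 (slH K) ∈ Submodule.span K (Set.range (genH a)) := by
        convert h using 1
        simp only [genH, Matrix.cons_val]
        module
      exact (Submodule.smul_mem_iff _ ha1).1 h'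
    · exact n1
    · exact n2
  · rw [Submodule.span_le]
    rintro _ ⟨i, rfl⟩
    fin_cases i
    · exact Submodule.smul_mem _ _ (Submodule.add_mem _ (Submodule.add_mem _
        (Submodule.smul_mem _ _ (m 0)) (m 1)) (Submodule.smul_mem _ _ (m 2)))
    · exact m 1
    · exact m 2

theorem bracket_proj (a : K) (v : Odd K) (s : Fin 2) (i : Fin 3) :
    ∃ x y : Carrier K, bracket a x (bracket a y (0, v)) =
      (0, fun p q r => if ![p, q, r] i = s then v p q r else 0) := by
  refine ⟨inEven i (![slE K, slF K] s), inEven i (![slF K, slE K] s), ?_⟩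
  fin_cases i
  · refine (congrArg _ (bracket_even_vec_zero a _ v)).trans ((bracket_even_vec_zero a _ _).trans ?_)
    refine Prod.ext rfl ?_
    funext p q r
    fin_cases s <;> fin_cases p <;> simp [slE, slF]
  · refine (congrArg _ (bracket_even_vec_one a _ v)).trans ((bracket_even_vec_one a _ _).trans ?_)
    refine Prod.ext rfl ?_
    funext p q r
    fin_cases s <;> fin_cases q <;> simp [slE, slF]
  · refine (congrArg _ (bracket_even_vec_two a _ v)).trans ((bracket_even_vec_two a _ _).trans ?_)
    refine Prod.ext rfl ?_
    funext p q r
    fin_cases s <;> fin_cases r <;> simp [slE, slF]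

/-- A homogeneous ideal of `D(2,1;a)` that meets `h` trivially is zero. -/
theorem ideal_eq_bot [CharZero K] (a : K) (I : Submodule K (Carrier K))
    (hI : ∀ x, ∀ y ∈ I, bracket a x y ∈ I) (hg : ∀ y ∈ I, ((y.1, 0) : Carrier K) ∈ I)
    (hc : I ⊓ cartan K = ⊥) : I = ⊥ := by
  have h2 : (2 : K) ≠ 0 := two_ne_zero
  have hodd : ∀ v : Odd K, ((0, v) : Carrier K) ∈ I → v = 0 := by
    intro v hv
    by_contra hne
    have hex : ∃ p q r, v p q r ≠ 0 := by
      by_contra hno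
      push Not at hno
      exact hne (funext fun p => funext fun q => funext fun r => hno p q r)
    obtain ⟨p, q, r, hpqr⟩ := hex
    obtain ⟨x0, y0, h0⟩ := bracket_proj a v p 0
    have m0 := hI x0 _ (hI y0 _ hv)
    rw [h0] at m0
    obtain ⟨x1, y1, h1⟩ := bracket_proj a (fun i j k => if ![i, j, k] 0 = p then v i j k else 0) q 1
    have m1 := hI x1 _ (hI y1 _ m0)
    rw [h1] at m1
    obtain ⟨x2, y2, h2⟩ := bracket_proj a (fun i j k => if ![i, j, k] 1 = q then
      (if ![i, j, k] 0 = p then v i j k else 0) else 0) r 2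
    have m2 := hI x2 _ (hI y2 _ m1)
    rw [h2] at m2
    have m3 : inOdd K p q r ∈ I := by
      rw [← I.smul_mem_iff hpqr]
      convert m2 using 1
      refine Prod.ext (by simp [inOdd]) ?_
      funext i j k
      simp only [inOdd, Prod.smul_mk, Pi.smul_apply, Matrix.cons_val, smul_eq_mul]
      by_cases hi : i = p <;> by_cases hj : j = q <;> by_cases hk : k = r <;> simp [hi, hj, hk]
    have hs : ∀ p : Fin 2, ∃ c : K, symProd (fun i j => if i = 1 - p ∧ j = p then (1 : K) else 0)
        = c • slH K ∧ c ≠ 0 := by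
      intro p
      refine ⟨-1, ?_, by simp⟩
      fin_cases p
      · simpa using (symProd_h (K := K)).2
      · simpa using (symProd_h (K := K)).1
    obtain ⟨c0, hc0, -⟩ := hs p
    obtain ⟨c1, hc1, hc1'⟩ := hs q
    obtain ⟨c2, hc2, -⟩ := hs r
    have m4 := hI (inOdd K (1 - p) (1 - q) (1 - r)) _ m3
    have m5 := m4
    rw [bracket_odd, hc0, hc1, hc2] at m5
    simp only [smul_smul, inEven_smul] at m5
    have m6 : _ ∈ cartan K := Submodule.add_mem _ (Submodule.add_mem _
      (Submodule.smul_mem _ (sigma a 0 * psi K (1 - q) q * psi K (1 - r) r * c0)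
        (Submodule.subset_span ⟨0, rfl⟩))
      (Submodule.smul_mem _ (sigma a 1 * psi K (1 - p) p * psi K (1 - r) r * c1)
        (Submodule.subset_span ⟨1, rfl⟩)))
      (Submodule.smul_mem _ (sigma a 2 * psi K (1 - p) p * psi K (1 - q) q * c2)
        (Submodule.subset_span ⟨2, rfl⟩))
    have m7 := Submodule.mem_inf.2 ⟨m5, m6⟩
    rw [hc, Submodule.mem_bot] at m7
    have m8 := congrArg (fun x : Carrier K => (x.1 1).1 0 0) m7
    have hp : ∀ p : Fin 2, psi K (1 - p) p ≠ 0 := by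
      intro p
      fin_cases p <;> simp [psi]
    simp [inEven, slH, sigma, hc1', hp] at m8
  rw [Submodule.eq_bot_iff]
  intro y hy
  have hy1 := hg y hy
  have hy2 : y.2 = 0 := by
    apply hodd
    have h := I.sub_mem hy hy1
    convert h using 1
    simp [Prod.ext_iff]
  have hz : ∀ p q r i j k, act y.1 (inOdd K p q r).2 i j k = 0 := by
    intro p q r i j k
    have h : act y.1 (inOdd K p q r).2 = 0 := by
      apply hodd
      have h := I.neg_mem (hI (inOdd K p q r) _ hy1)
      convert h using 1
      simp [bracket_apply, inOdd, evenBracket_zero_left, oddBracket_zero_right, act_zero_left]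
    rw [h]
    rfl
  refine carrier_ext (fun i p q => ?_) (fun p q r => by simp [hy2])
  have a1 := hz 0 0 0 0 0 0
  have a2 := hz 0 0 1 0 0 1
  have a3 := hz 0 1 0 0 1 0
  have a4 := hz 0 1 1 0 1 1
  have b1 := hz 0 0 0 1 0 0
  have b2 := hz 1 0 0 0 0 0
  have b3 := hz 0 0 0 0 1 0
  have b4 := hz 0 1 0 0 0 0
  have b5 := hz 0 0 0 0 0 1
  have b6 := hz 0 0 1 0 0 0
  simp [act, inOdd, sl_trace] at a1 a2 a3 a4 b1 b2 b3 b4 b5 b6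
  have c0 : 2 * (y.1 0).1 0 0 = 0 := by linear_combination a1 + a4
  have c1 : 2 * (y.1 1).1 0 0 = 0 := by linear_combination a2 - a4
  have c2 : 2 * (y.1 2).1 0 0 = 0 := by linear_combination a3 - a4
  have d0 := (mul_eq_zero.1 c0).resolve_left h2
  have d1 := (mul_eq_zero.1 c1).resolve_left h2
  have d2 := (mul_eq_zero.1 c2).resolve_left h2
  fin_cases i <;> fin_cases p <;> fin_cases q <;> simp [sl_trace, *]

/-! ### Roots, coroots and Chevalley bases -/

/-- The diagonal element `H_{2ε_i} = diag(1, -1)` of the `i`-th copy of `sl₂`. -/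
def diagH (K : Type*) [Field K] (i : Fin 3) : cartan K :=
  ⟨inEven i (slH K), Submodule.subset_span ⟨i, rfl⟩⟩

/-- The weight space `{x ∈ g | [H, x] = α(H) x for all H ∈ h}` of the adjoint action. -/
def rootSpace (a : K) (α : Module.Dual K (cartan K)) : Submodule K (Carrier K) :=
  ⨅ H : cartan K, LinearMap.ker (bracket a (H : Carrier K) - α H • LinearMap.id)

theorem mem_rootSpace (a : K) (α : Module.Dual K (cartan K)) (x : Carrier K) :
    x ∈ rootSpace a α ↔ ∀ H : cartan K, bracket a (H : Carrier K) x = α H • x := by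
  simp [rootSpace, sub_eq_zero]

/-- The set `Δ₀` of even roots. -/
def evenRoots (a : K) : Set (Module.Dual K (cartan K)) :=
  {α | α ≠ 0 ∧ rootSpace a α ⊓ part K 0 ≠ ⊥}

/-- The set `Δ₁` of odd roots. -/
def oddRoots (a : K) : Set (Module.Dual K (cartan K)) :=
  {α | rootSpace a α ⊓ part K 1 ≠ ⊥}

/-- The set `Δ = Δ₀ ∪ Δ₁` of roots. -/
def roots (a : K) : Set (Module.Dual K (cartan K)) := evenRoots a ∪ oddRoots a

/-- The set of negative odd roots `-ε₁ ± ε₂ ± ε₃`: the odd roots whose coefficient at `ε₁`,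
which is their value on `H_{2ε₁}`, is `-1`. -/
def negOddRoots (a : K) : Set (Module.Dual K (cartan K)) :=
  {α | α ∈ oddRoots a ∧ α (diagH K 0) = -1}

/-- The bilinear form on `h*` for which the basis `ε₁, ε₂, ε₃` dual to `H_{2ε₁}, H_{2ε₂}, H_{2ε₃}`
is orthogonal, with `(ε₁, ε₁) = -(1 + a) / 2`, `(ε₂, ε₂) = 1 / 2`, `(ε₃, ε₃) = a / 2`. -/
def form (a : K) (α β : Module.Dual K (cartan K)) : K :=
  ∑ i, sigma a i * α (diagH K i) * β (diagH K i)

/-- The element `t_α ∈ h` corresponding to `α` under the form: `β(t_α) = (α, β)` for all `β`. -/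
def dualVector (a : K) (α : Module.Dual K (cartan K)) : cartan K :=
  ∑ i, (sigma a i * α (diagH K i)) • diagH K i

theorem apply_dualVector (a : K) (α β : Module.Dual K (cartan K)) :
    β (dualVector a α) = form a α β := by
  simp [dualVector, form]

open Classical in
/-- The coroot `H_α` of a root `α`: `2 t_α / (α, α)` for the (non-isotropic) even roots, so that
`α(H_α) = 2`, and `-t_α` for the (isotropic) odd roots. -/
def coroot (a : K) (α : Module.Dual K (cartan K)) : cartan K :=
  if form a α α = 0 then -dualVector a α else (2 / form a α α) • dualVector a α

/-- The ring `ℤ[a]`, as a subring of `K`. -/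
def intAdjoin (a : K) : Subring K := Subring.closure {a}

/-- The ring `ℤ_a`: the subring of `K` generated by the binomial coefficients of the elements of
`ℤ[a]`. -/
def binomRing (a : K) : Subring K :=
  Subring.closure {z | ∃ P ∈ intAdjoin a, ∃ n : ℕ, z = binomCoeff K P n}

/-- A Chevalley basis `{H₁, H₂, H₃} ∪ {X_α}` of `D(2,1;a)`. -/
structure ChevalleyBasis (a : K) where
  H : Fin 3 → cartan K
  X : roots a → Carrier K
  linearIndependent :
    LinearIndependent K (Sum.elim (fun i => (H i : Carrier K)) X : Fin 3 ⊕ roots a → Carrier K)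
  span_eq_top : Submodule.span K
    (Set.range (Sum.elim (fun i => (H i : Carrier K)) X : Fin 3 ⊕ roots a → Carrier K)) = ⊤
  homogeneous : ∀ α, ∃ i, X α ∈ part K i
  span_H : Submodule.span K (Set.range H) = ⊤
  span_coroots : Submodule.span (intAdjoin a) (Set.range H) =
    Submodule.span (intAdjoin a) (coroot a '' roots a)
  bracket_H_H : ∀ i j, bracket a (H i : Carrier K) (H j) = 0
  bracket_H_X : ∀ i α, bracket a (H i : Carrier K) (X α) = α.1 (H i) • X α
  bracket_X_neg : ∀ α β : roots a, β.1 = -α.1 → α.1 ∉ negOddRoots a →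
    bracket a (X α) (X β) = coroot a α.1
  bracket_X_neg' : ∀ α β : roots a, β.1 = -α.1 → α.1 ∈ negOddRoots a →
    bracket a (X α) (X β) = -(coroot a α.1 : Carrier K)
  bracket_X_X_zero : ∀ α β : roots a, α.1 + β.1 ≠ 0 → α.1 + β.1 ∉ roots a →
    bracket a (X α) (X β) = 0
  /-- If `β - r α, …, β + q α` is the `α`-string through `β`, the structure constant is
  `± (r + 1)`. -/
  bracket_X_X : ∀ α β γ : roots a, α.1 + β.1 ≠ 0 → γ.1 = α.1 + β.1 →
    (form a α.1 α.1 ≠ 0 ∨ form a β.1 β.1 ≠ 0) →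
    ∃ r q : ℕ, {k : ℤ | β.1 + k • α.1 ∈ roots a ∪ {0}} = Set.Icc (-(r : ℤ)) q ∧
      (bracket a (X α) (X β) = ((r : K) + 1) • X γ ∨
        bracket a (X α) (X β) = -(((r : K) + 1) • X γ))
  bracket_X_X' : ∀ α β γ : roots a, α.1 + β.1 ≠ 0 → γ.1 = α.1 + β.1 →
    form a α.1 α.1 = 0 → form a β.1 β.1 = 0 →
    bracket a (X α) (X β) = β.1 (coroot a α.1) • X γ ∨
      bracket a (X α) (X β) = -(β.1 (coroot a α.1) • X γ)

/-! ### The Kostant superalgebra, rational modules and admissible lattices -/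

variable [CharZero K] {a : K} {V : Type*} [AddCommGroup V] [Module K V]

/-- The Kostant superalgebra: the `ℤ_a`-subalgebra of `U(g)` generated by the divided powers of
the even root vectors, the odd root vectors, and the binomial coefficients of the elements of
the `ℤ[a]`-span of `H₁, H₂, H₃`. -/
def kostant (B : ChevalleyBasis a) : Subalgebra (binomRing a) (LieSuperalgebra.Env (algebra a)) :=
  Algebra.adjoin (binomRing a)
    ({u | ∃ α : roots a, α.1 ∈ evenRoots a ∧ ∃ n : ℕ,
        u = dividedPow K (LieSuperalgebra.Env.of (algebra a) (B.X α)) n} ∪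
      {u | ∃ γ : roots a, γ.1 ∈ oddRoots a ∧ u = LieSuperalgebra.Env.of (algebra a) (B.X γ)} ∪
      {u | ∃ H ∈ Submodule.span (intAdjoin a) (Set.range B.H), ∃ n : ℕ,
        u = binomCoeff K (LieSuperalgebra.Env.of (algebra a) (H : Carrier K)) n})

/-- The weight space `V_μ = {v ∈ V | H . v = μ(H) v for all H ∈ h}`. -/
def weightSpace (ρ : LieSuperalgebra.Rep (algebra a) V) (μ : Module.Dual K (cartan K)) :
    Submodule K V :=
  ⨅ H : cartan K, LinearMap.ker (ρ.toHom (H : Carrier K) - μ H • 1)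

theorem mem_weightSpace (ρ : LieSuperalgebra.Rep (algebra a) V) (μ : Module.Dual K (cartan K))
    (v : V) : v ∈ weightSpace ρ μ ↔ ∀ H : cartan K, ρ.toHom (H : Carrier K) v = μ H • v := by
  simp [weightSpace, sub_eq_zero]

/-- The set `Λ` of weights of `V`. -/
def weights (ρ : LieSuperalgebra.Rep (algebra a) V) : Set (Module.Dual K (cartan K)) :=
  {μ | weightSpace ρ μ ≠ ⊥}

/-- Rational modules.  The sum of the weight spaces is automatically direct. -/
structure IsRational (B : ChevalleyBasis a) (ρ : LieSuperalgebra.Rep (algebra a) V) : Prop where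
  iSup_weightSpace : ⨆ μ, weightSpace ρ μ = ⊤
  apply_H : ∀ μ ∈ weights ρ, ∀ i, μ (B.H i) ∈ intAdjoin a
  apply_coroot : ∀ μ ∈ weights ρ, ∀ α ∈ evenRoots a, ∃ n : ℤ, μ (coroot a α) = n

/-- Admissible lattices: the `ℤ_a`-lattices of `V` that are stable under the Kostant
superalgebra. -/
structure IsAdmissible (B : ChevalleyBasis a) (ρ : LieSuperalgebra.Rep (algebra a) V)
    (M : Submodule (binomRing a) V) : Prop where
  isLattice : IsLatticeOver (binomRing a) M
  stable : ∀ u ∈ kostant B, ∀ m ∈ M, ρ.envAction u m ∈ M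

/-- `h_V = {H ∈ h | μ(H) ∈ ℤ_a for all weights μ of V}`, as a `ℤ_a`-submodule of `g`. -/
def cartanStabilizer (ρ : LieSuperalgebra.Rep (algebra a) V) :
    Submodule (binomRing a) (Carrier K) where
  carrier := {x | ∃ H : cartan K, (H : Carrier K) = x ∧ ∀ μ ∈ weights ρ, μ H ∈ binomRing a}
  zero_mem' := ⟨0, rfl, fun μ _ => by simp⟩
  add_mem' := by
    rintro _ _ ⟨x, rfl, hx⟩ ⟨y, rfl, hy⟩
    exact ⟨x + y, rfl, fun μ hμ => by simpa using add_mem (hx μ hμ) (hy μ hμ)⟩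
  smul_mem' := by
    rintro c _ ⟨x, rfl, hx⟩
    exact ⟨(c : K) • x, rfl, fun μ hμ => by simpa using mul_mem c.2 (hx μ hμ)⟩

end D21

end

/-!
On `V` the coroots `H_{2εᵢ}` act diagonally with integral eigenvalues, so every projection of `V`
onto a weight space is an integer-valued polynomial in them; it therefore comes from the Kostant
superalgebra and preserves `M`.  Cutting `X ∈ g_V` with these projections shows that each component
of `X` along `h ⊕ ⨁ K X_α` already preserves `M`, and that an element `H` of `h` preserves `M` if
and only if all `μ(H)` lie in `ℤ_a`.

If `c X_α` preserves `M` with `α` even, choose a weight `μ` with `m = μ(H_α) > 0` maximal.  Acting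
on `V_μ`, the bracket `[c X_α, X_{-α}]` is `c m` and `(c X_α)^m X_{-α}^m / m!` is `c^m m!`, so both
scalars lie in `ℤ_a`.  Since Fermat's little theorem makes the ideal `p ℤ_a` radical for every
prime `p`, the primes can be cancelled one at a time and `c ∈ ℤ_a`.  For an odd `α` there is an odd
`β` with `α + β` even and `[X_α, X_β] = ± X_{α+β}`, which reduces the claim to the even case.

Finally, as `V` is faithful, its weights generate a full `ℤ`-lattice in the dual of `h`, and the
`ℤ_a`-span of a basis dual to one of that lattice is `h_V`.
-/

noncomputable section

section IntegerValued

open Polynomial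

variable {K A B : Type*} [Field K] [Ring A] [Algebra K A] [Ring B] [Algebra K B]

theorem map_binomCoeff (f : A →ₐ[K] B) (y : A) (n : ℕ) :
    f (binomCoeff K y n) = binomCoeff K (f y) n := by
  rw [binomCoeff, binomCoeff, map_smul, aeval_algHom_apply]

theorem map_dividedPow (f : A →ₐ[K] B) (y : A) (n : ℕ) :
    f (dividedPow K y n) = dividedPow K (f y) n := by
  rw [dividedPow, dividedPow, map_smul, map_pow]

theorem aeval_binomCoeff_X (y : A) (n : ℕ) :
    aeval y (binomCoeff K (X : K[X]) n) = binomCoeff K y n := by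
  rw [map_binomCoeff, aeval_X]

theorem natDegree_binomCoeff_X_le (n : ℕ) : (binomCoeff K (X : K[X]) n).natDegree ≤ n := by
  rw [binomCoeff, aeval_X_left_apply]
  exact (natDegree_smul_le _ _).trans (descPochhammer_natDegree K n).le

variable [CharZero K]

theorem binomCoeff_intCast (z : ℤ) (n : ℕ) : binomCoeff K (z : K) n = (Ring.choose z n : ℤ) := by
  rw [binomCoeff, coe_aeval_eq_eval, ← descPochhammer_map (Int.castRingHom K), eval_intCast_map,
    ← coe_aeval_eq_eval, aeval_eq_smeval, Ring.descPochhammer_eq_factorial_smul_choose]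
  simp [Nat.factorial_ne_zero]

theorem binomCoeff_natCast (m n : ℕ) : binomCoeff K (m : K) n = (m.choose n : K) := by
  simpa [Ring.choose_natCast] using binomCoeff_intCast (K := K) m n

variable (K) in
/-- The ring of integer-valued polynomials: those taking integral values at all natural numbers
(and hence at all integers). -/
def integerValued : Subring K[X] :=
  ⨅ m : ℕ, (Int.castRingHom K).range.comap (evalRingHom (m : K))

omit [CharZero K] in
theorem mem_integerValued {f : K[X]} :
    f ∈ integerValued K ↔ ∀ m : ℕ, ∃ z : ℤ, f.eval (m : K) = z := by
  simp [integerValued, Subring.mem_iInf, eq_comm]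

theorem eq_sum_fwdDiff_smul_binomCoeff {f : K[X]} {c : ℕ → ℤ} (hc : ∀ m : ℕ, f.eval (m : K) = c m) :
    f = ∑ k ∈ Finset.range (f.natDegree + 1), (fwdDiff 1)^[k] c 0 • binomCoeff K (X : K[X]) k := by
  refine eq_of_natDegree_lt_card_of_eval_eq f _
    (f := fun i : Fin (f.natDegree + 1) => ((i : ℕ) : K))
    (Nat.cast_injective.comp Fin.val_injective) (fun i => ?_) ?_
  · have hnewton := shift_eq_sum_fwdDiff_iter 1 c i 0
    rw [zero_add, smul_eq_mul, mul_one, Finset.sum_subset (Finset.range_mono i.isLt)] at hnewton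
    · simp [eval_finsetSum, hc, hnewton, ← coe_aeval_eq_eval, aeval_binomCoeff_X,
        binomCoeff_natCast, mul_comm]
    · intro k _ hk
      rw [Nat.choose_eq_zero_of_lt (by simpa using hk), zero_smul]
  · simp only [Fintype.card_fin, Nat.lt_succ_iff, max_le_iff, le_refl, true_and]
    refine natDegree_sum_le_of_forall_le _ _ fun k hk => ?_
    exact (natDegree_smul_le _ _).trans
      ((natDegree_binomCoeff_X_le k).trans (Nat.lt_succ_iff.1 (Finset.mem_range.1 hk)))

theorem aeval_mem_of_mem_integerValued {σ : Type*} [SetLike σ A] [AddSubgroupClass σ A] {S : σ}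
    {y : A} (hy : ∀ n, binomCoeff K y n ∈ S) {f : K[X]} (hf : f ∈ integerValued K) :
    aeval y f ∈ S := by
  choose c hc using mem_integerValued.1 hf
  rw [eq_sum_fwdDiff_smul_binomCoeff hc, map_sum]
  refine sum_mem fun k _ => ?_
  rw [map_zsmul, aeval_binomCoeff_X]
  exact zsmul_mem (hy k) _

/-- The product of `binom(X + N - k, N)` and `binom(-X + N + k, N)` vanishes at the integers at
distance at most `N` from `k`, except at `k` itself. -/
theorem exists_integerValued_indicator {F : Set ℤ} (hF : F.Finite) (k : ℤ) :
    ∃ f ∈ integerValued K, ∀ n ∈ F, f.eval (n : K) = if n = k then 1 else 0 := by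
  obtain ⟨N, hN⟩ : ∃ N : ℕ, ∀ n ∈ F, (n - k).natAbs ≤ N := by
    obtain ⟨N, hN⟩ := (hF.image fun n => (n - k).natAbs).bddAbove
    exact ⟨N, fun n hn => hN ⟨n, hn, rfl⟩⟩
  let b (y : K[X]) : K[X] := binomCoeff K y N
  have heval (y : K[X]) (n w : ℤ) (hw : y.eval (n : K) = w) :
      (b y).eval (n : K) = (Ring.choose w N : ℤ) := by
    rw [← coe_aeval_eq_eval, map_binomCoeff, coe_aeval_eq_eval, hw, binomCoeff_intCast]
  have hvalue (n : ℤ) : (b (X + C ((N - k : ℤ) : K)) * b (-X + C ((N + k : ℤ) : K))).eval (n : K) =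
      ((Ring.choose (n - k + N) N * Ring.choose (k - n + N) N : ℤ) : K) := by
    rw [eval_mul, heval _ n (n - k + N) (by simp; ring), heval _ n (k - n + N) (by simp; ring)]
    push_cast
    rfl
  refine ⟨_, mem_integerValued.2 fun m => ⟨_, by exact_mod_cast hvalue m⟩, fun n hn => ?_⟩
  rw [hvalue]
  have hn := hN n hn
  have hzero {x : ℤ} (h0 : 0 ≤ x) (hx : x < N) : Ring.choose x N = 0 := by
    lift x to ℕ using h0
    rw [Ring.choose_natCast, Nat.choose_eq_zero_of_lt (by omega), Nat.cast_zero]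
  rcases lt_trichotomy n k with h | rfl | h
  · rw [hzero (x := n - k + N) (by omega) (by omega), zero_mul, if_neg h.ne, Int.cast_zero]
  · simp [Ring.choose_natCast]
  · rw [hzero (x := k - n + N) (by omega) (by omega), mul_zero, if_neg h.ne', Int.cast_zero]

end IntegerValued

section Fermat

/-- The elements of a commutative ring that satisfy Fermat's congruence `x ^ p ≡ x` modulo `p`. -/
def fermatSubring (R : Type*) [CommRing R] (p : ℕ) [hp : Fact p.Prime] : Subring R where
  carrier := {x | (p : R) ∣ x ^ p - x}
  zero_mem' := by simp [hp.out.ne_zero]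
  one_mem' := by simp
  mul_mem' := by
    intro x y hx hy
    have hsplit : (x * y) ^ p - x * y = (x ^ p - x) * y ^ p + x * (y ^ p - y) := by ring
    exact (congrArg _ hsplit).mpr ((hx.mul_right _).add (hy.mul_left _))
  add_mem' := by
    intro x y hx hy
    obtain ⟨r, hr⟩ := exists_add_pow_prime_eq hp.out x y
    have hsplit : (x + y) ^ p - (x + y) = (x ^ p - x) + (y ^ p - y) + p * (x * y * r) := by
      rw [hr]; ring
    exact (congrArg _ hsplit).mpr ((hx.add hy).add (dvd_mul_right _ _))
  neg_mem' := by
    intro x hx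
    obtain ⟨r, hr⟩ := exists_add_pow_prime_eq hp.out x (-x)
    rw [add_neg_cancel, zero_pow hp.out.ne_zero] at hr
    have hsplit : (-x) ^ p - -x = -(x ^ p - x) + p * (x * x * r) := by linear_combination -hr
    exact (congrArg _ hsplit).mpr ((dvd_neg.2 hx).add (dvd_mul_right _ _))

theorem isRadical_natCast_of_fermatSubring_eq_top {R : Type*} [CommRing R] {p : ℕ}
    [hp : Fact p.Prime] (h : fermatSubring R p = ⊤) : IsRadical (p : R) := by
  refine (isRadical_iff_pow_one_lt p hp.out.one_lt).2 fun x hx => ?_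
  have hfermat : (p : R) ∣ x ^ p - x := h.ge (Subring.mem_top x)
  exact (dvd_sub_right hx).1 hfermat

open Polynomial in
theorem isRadical_natCast_closure_binomCoeff {K : Type*} [Field K] [CharZero K] (S : Set K)
    {p : ℕ} (hp : p.Prime) :
    IsRadical (p : Subring.closure {z | ∃ x ∈ S, ∃ n, z = binomCoeff K x n}) := by
  have : Fact p.Prime := ⟨hp⟩
  have hp0 : (p : K) ≠ 0 := Nat.cast_ne_zero.2 hp.ne_zero
  set R := Subring.closure {z | ∃ x ∈ S, ∃ n, z = binomCoeff K x n} with hR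
  suffices hle : R ≤ (fermatSubring R p).map R.subtype by
    refine isRadical_natCast_of_fermatSubring_eq_top (eq_top_iff.2 fun x _ => ?_)
    obtain ⟨y, hy, hyx⟩ := hle x.2
    rwa [← Subtype.ext hyx]
  rw [hR, Subring.closure_le, ← hR]
  rintro _ ⟨x, hx, n, rfl⟩
  have hbinom (k : ℕ) : binomCoeff K x k ∈ R := Subring.subset_closure ⟨x, hx, k, rfl⟩
  let b : K[X] := binomCoeff K X n
  have hquotient : (p : K)⁻¹ • (b ^ p - b) ∈ integerValued K := by
    refine mem_integerValued.2 fun m => ?_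
    obtain ⟨z, hz⟩ := Int.prime_dvd_pow_self_sub hp (m.choose n)
    refine ⟨z, ?_⟩
    rw [eval_smul, eval_sub, eval_pow, ← coe_aeval_eq_eval, aeval_binomCoeff_X, binomCoeff_natCast,
      smul_eq_mul, inv_mul_eq_iff_eq_mul₀ hp0]
    exact_mod_cast congrArg (Int.cast : ℤ → K) hz
  refine ⟨⟨_, hbinom n⟩, ⟨⟨_, aeval_mem_of_mem_integerValued hbinom hquotient⟩,
    Subtype.ext ?_⟩, rfl⟩
  simp [b, -coe_aeval_eq_eval, aeval_binomCoeff_X, hp0]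

variable {K : Type*} [Field K] [CharZero K] {R : Subring K}

theorem mem_of_prime_mul_mem {p : ℕ} (hp : p.Prime) (hR : IsRadical (p : R)) {c : K} {m : ℕ}
    (hm : m ≠ 0) (h : p * c ∈ R) (h' : c ^ m * m ! ∈ R) : c ∈ R := by
  have : Fact p.Prime := ⟨hp⟩
  have hp0 : (p : K) ≠ 0 := Nat.cast_ne_zero.2 hp.ne_zero
  obtain ⟨e, u, hpu, hu⟩ := Nat.exists_eq_pow_mul_and_not_dvd m.factorial_ne_zero p hp.ne_one
  have he : e < m := by
    calc e ≤ padicValNat p (m !) :=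
          (padicValNat_dvd_iff_le m.factorial_ne_zero).1 (hu ▸ dvd_mul_right _ _)
      _ ≤ (p - 1) * padicValNat p (m !) :=
          Nat.le_mul_of_pos_left _ (Nat.sub_pos_of_lt hp.one_lt)
      _ < m := sub_one_mul_padicValNat_factorial_lt_of_ne_zero _ hm
  obtain ⟨k, rfl⟩ := Nat.exists_eq_add_of_lt he
  let b : R := ⟨_, h⟩
  have hdvd : (p : R) ∣ b ^ (e + k + 1) * u := by
    refine ⟨p ^ k * ⟨_, h'⟩, Subtype.ext ?_⟩
    simp only [b, hu, Subring.coe_mul, Subring.coe_pow, Subring.coe_natCast, Nat.cast_mul,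
      Nat.cast_pow]
    ring
  have hcoprime : IsCoprime (p : R) (u : R) := ((hp.coprime_iff_not_dvd).2 hpu).cast
  obtain ⟨z, hz⟩ := hR _ _ (hcoprime.dvd_of_dvd_mul_right hdvd)
  have hcz : c = z := mul_left_cancel₀ hp0 (by simpa [b] using congrArg Subtype.val hz)
  exact hcz ▸ z.2

theorem mem_of_natCast_mul_mem (hR : ∀ p : ℕ, p.Prime → IsRadical (p : R)) {c : K} {m n : ℕ}
    (hm : m ≠ 0) (hn : n ≠ 0) (h : n * c ∈ R) (h' : c ^ m * m ! ∈ R) : c ∈ R := by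
  induction n using Nat.recOnMul generalizing c with
  | zero => exact absurd rfl hn
  | one => simpa using h
  | prime p hp => exact mem_of_prime_mul_mem hp (hR p hp) hm h h'
  | mul k l ihk ihl =>
    refine ihl (right_ne_zero_of_mul hn) (ihk (left_ne_zero_of_mul hn) ?_ ?_) h'
    · simpa [mul_assoc] using h
    · rw [mul_pow, mul_assoc]
      exact mul_mem (pow_mem (natCast_mem R l) m) h'

end Fermat

section LatticeEnd

theorem span_entries_eq_top_of_isIdempotentElem {R ι : Type*} [CommRing R] [IsDomain R] [Fintype ι]
    {A : Matrix ι ι R} (hA : IsIdempotentElem A) (hA0 : A ≠ 0) :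
    Ideal.span (Set.range fun ij : ι × ι => A ij.1 ij.2) = ⊤ := by
  set I := Ideal.span (Set.range fun ij : ι × ι => A ij.1 ij.2) with hI
  have hmem (i j : ι) : A i j ∈ I := Ideal.subset_span ⟨(i, j), rfl⟩
  have hidem : IsIdempotentElem I := by
    refine le_antisymm Ideal.mul_le_left ?_
    conv_lhs => rw [hI]
    rw [Ideal.span_le]
    rintro _ ⟨⟨i, j⟩, rfl⟩
    dsimp only
    rw [← hA.eq, Matrix.mul_apply]
    exact sum_mem fun k _ => Ideal.mul_mem_mul (hmem i k) (hmem k j)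
  refine ((Ideal.isIdempotentElem_iff_eq_bot_or_top I
    (Submodule.fg_span (Set.finite_range _))).1 hidem).resolve_left fun hbot => hA0 ?_
  ext i j
  simpa [hbot] using hmem i j

variable {K V : Type*} [Field K] [AddCommGroup V] [Module K V] {R : Subring K} {M : Submodule R V}

/-- The ring of the operators that preserve a lattice. -/
def latticeEnd (M : Submodule R V) : Subring (Module.End K V) where
  carrier := {T | ∀ m ∈ M, T m ∈ M}
  mul_mem' := fun hS hT m hm => hS _ (hT m hm)
  one_mem' := fun _ hm => hm
  add_mem' := fun hS hT m hm => M.add_mem (hS m hm) (hT m hm)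
  zero_mem' := fun _ _ => M.zero_mem
  neg_mem' := fun hS m hm => M.neg_mem (hS m hm)

theorem smul_mem_latticeEnd {c : K} (hc : c ∈ R) {T : Module.End K V} (hT : T ∈ latticeEnd M) :
    c • T ∈ latticeEnd M :=
  fun m hm => M.smul_mem ⟨c, hc⟩ (hT m hm)

theorem IsLatticeOver.exists_basis (hM : IsLatticeOver R M) :
    ∃ (s : Set V) (b : Module.Basis s K V), ∀ v, v ∈ M ↔ ∀ i, b.repr v i ∈ R := by
  obtain ⟨s, hs, hspan, rfl⟩ := hM
  let b : Module.Basis s K V := Module.Basis.mk hs (by simpa using hspan.ge)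
  have hb : Set.range b = s := by simp [b]
  refine ⟨s, b, fun v => ?_⟩
  simpa [hb, Algebra.algebraMap_ofSubring] using b.mem_span_iff_repr_mem R v

theorem repr_apply_mem_of_mem_latticeEnd {ι : Type*} (b : Module.Basis ι K V)
    (hb : ∀ v, v ∈ M ↔ ∀ i, b.repr v i ∈ R) {T : Module.End K V} (hT : T ∈ latticeEnd M)
    (i j : ι) : b.repr (T (b j)) i ∈ R := by
  classical
  refine (hb _).1 (hT _ ((hb _).2 fun k => ?_)) i
  rw [b.repr_self_apply]
  split_ifs
  exacts [one_mem R, zero_mem R]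

theorem IsLatticeOver.mem_of_smul_mem_latticeEnd [FiniteDimensional K V] (hM : IsLatticeOver R M)
    {e : Module.End K V} (he : IsIdempotentElem e) (he0 : e ≠ 0) (heM : e ∈ latticeEnd M) {c : K}
    (hc : c • e ∈ latticeEnd M) : c ∈ R := by
  classical
  obtain ⟨s, b, hb⟩ := hM.exists_basis
  have : Fintype s := FiniteDimensional.fintypeBasisIndex b
  let A : Matrix s s R := .of fun i j => ⟨_, repr_apply_mem_of_mem_latticeEnd b hb heM i j⟩
  have hA : A.map R.subtype = LinearMap.toMatrix b b e := by
    ext i j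
    simp [A, LinearMap.toMatrix_apply]
  have hA_idem : IsIdempotentElem A := by
    refine Matrix.map_injective R.subtype_injective ?_
    simp only
    rw [Matrix.map_mul, hA, ← LinearMap.toMatrix_mul, he.eq]
  have hA0 : A ≠ 0 := by
    rintro h
    rw [h, Matrix.map_zero _ (map_zero _), eq_comm, LinearEquiv.map_eq_zero_iff] at hA
    exact he0 hA
  let J : Ideal R := (1 : Submodule R K).comap (c • Algebra.linearMap R K)
  have hJ : Ideal.span (Set.range fun ij : s × s => A ij.1 ij.2) ≤ J := by
    rw [Ideal.span_le]
    rintro _ ⟨⟨i, j⟩, rfl⟩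
    have hij := repr_apply_mem_of_mem_latticeEnd b hb hc i j
    simp only [LinearMap.smul_apply, map_smul, Finsupp.smul_apply] at hij
    exact Submodule.mem_one.2 ⟨⟨_, hij⟩, rfl⟩
  rw [span_entries_eq_top_of_isIdempotentElem hA_idem hA0] at hJ
  obtain ⟨x, hx⟩ := Submodule.mem_one.1 (hJ (Submodule.mem_top (x := 1)))
  have hxc : algebraMap R K x = c := by simpa using hx
  exact hxc ▸ x.2

end LatticeEnd

section Sl2

/-! ### Finite-dimensional representations of `sl₂` -/

attribute [local instance] LieRing.ofAssociativeRing

variable {K V : Type*} [Field K] [AddCommGroup V] [Module K V] {h e f : Module.End K V}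

theorem pow_mul_pow_apply_of_hasPrimitiveVectorWith {t : IsSl2Triple h e f} {v : V} {m : ℕ}
    (P : t.HasPrimitiveVectorWith v (m : K)) : (e ^ m * f ^ m) v = ((m ! : K) * m !) • v := by
  have key (j : ℕ) (hj : j ≤ m) : (e ^ j * f ^ j) v = ((j ! : K) * m.descFactorial j) • v := by
    induction j with
    | zero => simp
    | succ j ih =>
      have hstep : e ((f ^ (j + 1)) v) = (((j : K) + 1) * (m - j)) • (f ^ j) v := by
        simpa using P.lie_e_pow_succ_toEnd_f j
      rw [Module.End.mul_apply, pow_succ e, Module.End.mul_apply, hstep, map_smul,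
        ← Module.End.mul_apply, ih (by omega), smul_smul, Nat.factorial_succ,
        Nat.descFactorial_succ]
      push_cast [Nat.cast_sub (show j ≤ m by omega)]
      congr 1
      ring
  rw [key m le_rfl, Nat.descFactorial_self]

theorem hasEigenvalue_neg_of_hasPrimitiveVectorWith [CharZero K] {t : IsSl2Triple h e f} {v : V}
    {m : ℕ} (P : t.HasPrimitiveVectorWith v (m : K)) : h.HasEigenvalue (-m) := by
  refine Module.End.hasEigenvalue_of_hasEigenvector (x := (f ^ m) v)
    ⟨Module.End.mem_eigenspace_iff.2 ?_, by simpa using P.pow_toEnd_f_ne_zero_of_eq_nat rfl le_rfl⟩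
  have := P.lie_h_pow_toEnd_f m
  rw [LieModule.toEnd_module_end, LieHom.id_apply, Module.End.lie_apply] at this
  rw [this]
  congr 1
  ring

variable [CharZero K] [FiniteDimensional K V]

theorem exists_hasPrimitiveVectorWith_of_hasEigenvalue (t : IsSl2Triple h e f) {c : K}
    (hc : h.HasEigenvalue c) : ∃ (v : V) (j m : ℕ), c + 2 * j = m ∧
      t.HasPrimitiveVectorWith v (m : K) := by
  obtain ⟨v, hv, hv₀⟩ := hc.exists_hasEigenvector
  rw [Module.End.mem_eigenspace_iff] at hv
  have hpow (j : ℕ) : h ((e ^ j) v) = (c + 2 * j) • (e ^ j) v := by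
    simpa using t.lie_h_pow_toEnd_e (M := V) hv j
  obtain ⟨j, hj⟩ : ∃ j, (e ^ j) v = 0 := by
    by_contra! hne
    have hinf : (Set.range fun j : ℕ => c + 2 * j).Infinite :=
      Set.infinite_range_of_injective fun i j hij => by simpa using hij
    refine hinf ((Module.End.finite_hasEigenvalue h).subset ?_)
    rintro _ ⟨j, rfl⟩
    exact Module.End.hasEigenvalue_of_hasEigenvector
      ⟨Module.End.mem_eigenspace_iff.2 (hpow j), hne j⟩
  obtain ⟨j, hj₀, hj₁⟩ := Nat.exists_not_and_succ_of_not_zero_of_exists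
    (p := fun j => (e ^ j) v = 0) (by simpa using hv₀) ⟨j, hj⟩
  have P : t.HasPrimitiveVectorWith ((e ^ j) v) (c + 2 * j) :=
    ⟨hj₀, hpow j, by simpa [pow_succ'] using hj₁⟩
  obtain ⟨m, hm⟩ := P.exists_nat
  exact ⟨_, j, m, hm, hm ▸ P⟩

theorem exists_int_eq_of_hasEigenvalue (t : IsSl2Triple h e f) {c : K} (hc : h.HasEigenvalue c) :
    ∃ n : ℤ, c = n := by
  obtain ⟨-, j, m, hm, -⟩ := exists_hasPrimitiveVectorWith_of_hasEigenvalue t hc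
  exact ⟨m - 2 * j, by push_cast; linear_combination hm⟩

theorem exists_pos_hasEigenvalue (t : IsSl2Triple h e f) {c : K} (hc : h.HasEigenvalue c)
    (hc₀ : c ≠ 0) : ∃ m : ℕ, 0 < m ∧ h.HasEigenvalue (m : K) := by
  obtain ⟨n, rfl⟩ := exists_int_eq_of_hasEigenvalue t hc
  obtain hn | hn := (Int.cast_ne_zero.1 hc₀).lt_or_gt
  · have hc' : (-h).HasEigenvalue (-n) := Module.End.hasEigenvalue_neg_iff.2 (by rwa [neg_neg])
    obtain ⟨v, j, m, hm, P⟩ := exists_hasPrimitiveVectorWith_of_hasEigenvalue t.symm hc'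
    have hm' : -n + 2 * (j : ℤ) = m := by exact_mod_cast hm
    have hmh := Module.End.hasEigenvalue_neg_iff.1 (hasEigenvalue_neg_of_hasPrimitiveVectorWith P)
    exact ⟨m, by omega, by rwa [neg_neg] at hmh⟩
  · exact ⟨n.toNat, by omega, by
      rwa [← Int.cast_natCast (R := K), Int.toNat_of_nonneg hn.le]⟩

end Sl2

namespace D21

section Roots

variable {K : Type*} [Field K]

/-! ### Roots and coroots in coordinates -/

theorem linearIndependent_inEven_slH :
    LinearIndependent K fun i : Fin 3 => inEven i (slH K) := by
  rw [Fintype.linearIndependent_iff]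
  intro c hc i
  have hi := congrArg (fun x : Carrier K => (x.1 i).1 0 0) hc
  fin_cases i <;> simpa [Fin.sum_univ_three, inEven, slH] using hi

/-- The basis `H_{2ε₁}, H_{2ε₂}, H_{2ε₃}` of the Cartan subalgebra. -/
def cartanBasis (K : Type*) [Field K] : Module.Basis (Fin 3) K (cartan K) :=
  Module.Basis.span linearIndependent_inEven_slH

theorem cartanBasis_apply (i : Fin 3) : cartanBasis K i = diagH K i :=
  Module.Basis.span_apply _ i

theorem dual_ext {α β : Module.Dual K (cartan K)} (h : ∀ i, α (diagH K i) = β (diagH K i)) :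
    α = β :=
  (cartanBasis K).ext fun i => by simpa only [cartanBasis_apply] using h i

/-- The functional `c₁ε₁ + c₂ε₂ + c₃ε₃`, where `(εᵢ)` is the basis dual to `(H_{2εᵢ})`. -/
def wt : (Fin 3 → K) ≃ₗ[K] Module.Dual K (cartan K) := (cartanBasis K).constr K

@[simp]
theorem wt_diagH (c : Fin 3 → K) (i : Fin 3) : wt c (diagH K i) = c i := by
  rw [← cartanBasis_apply]
  exact (cartanBasis K).constr_basis K c i

theorem mem_rootSpace_iff {a : K} {α : Module.Dual K (cartan K)} {x : Carrier K} :
    x ∈ rootSpace a α ↔ ∀ i, bracket a (diagH K i : Carrier K) x = α (diagH K i) • x := by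
  rw [mem_rootSpace]
  refine ⟨fun h i => h _, fun h H => ?_⟩
  rw [← (cartanBasis K).sum_repr H]
  simp only [cartanBasis_apply, Submodule.coe_sum, Submodule.coe_smul, map_sum, map_smul,
    LinearMap.sum_apply, LinearMap.smul_apply, h, smul_smul, Finset.sum_smul, smul_eq_mul]

theorem bracket_diagH_fst (a : K) (i j : Fin 3) (x : Carrier K) :
    (bracket a (diagH K i : Carrier K) x).1 j = if i = j then ⁅slH K, x.1 j⁆ else 0 := by
  have h : (bracket a (diagH K i : Carrier K) x).1 j =
      ⁅(Pi.single i (slH K) : Fin 3 → LieAlgebra.SpecialLinear.sl (Fin 2) K) j, x.1 j⁆ := by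
    simp [bracket_apply, diagH, inEven, oddBracket_zero_left, evenBracket]
  rw [h, Pi.single_apply]
  split_ifs with h₁ h₂ h₂
  exacts [rfl, (h₂ h₁.symm).elim, (h₁ h₂.symm).elim, zero_lie _]

theorem bracket_diagH_snd (a : K) (i : Fin 3) (x : Carrier K) (p : Fin 3 → Fin 2) :
    (bracket a (diagH K i : Carrier K) x).2 (p 0) (p 1) (p 2) =
      (-1) ^ (p i : ℕ) * x.2 (p 0) (p 1) (p 2) := by
  have h : (bracket a (diagH K i : Carrier K) x).2 = act (inEven i (slH K)).1 x.2 := by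
    simp [bracket_apply, diagH, inEven, act_zero_right]
  rw [h]
  generalize hp : p i = t
  fin_cases i <;> fin_cases t <;> simp_all [act, inEven, slH, Fin.sum_univ_two]

variable {a : K} {α : Module.Dual K (cartan K)} {x : Carrier K}

theorem eq_wt_single_of_fst_zero_one_ne_zero (hx : x ∈ rootSpace a α) {j : Fin 3}
    (h : (x.1 j).1 0 1 ≠ 0) : α = wt (Pi.single j 2) := by
  refine dual_ext fun i => ?_
  have hi := congrArg (fun y : Carrier K => (y.1 j).1 0 1) (mem_rootSpace_iff.1 hx i)
  rw [bracket_diagH_fst] at hi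
  refine mul_right_cancel₀ h (hi.symm.trans ?_)
  obtain rfl | hij := eq_or_ne i j
  · simp [sl_lie_apply, slH]
    ring
  · simp [hij]

theorem eq_wt_single_of_fst_one_zero_ne_zero (hx : x ∈ rootSpace a α) {j : Fin 3}
    (h : (x.1 j).1 1 0 ≠ 0) : α = wt (Pi.single j (-2)) := by
  refine dual_ext fun i => ?_
  have hi := congrArg (fun y : Carrier K => (y.1 j).1 1 0) (mem_rootSpace_iff.1 hx i)
  rw [bracket_diagH_fst] at hi
  refine mul_right_cancel₀ h (hi.symm.trans ?_)
  obtain rfl | hij := eq_or_ne i j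
  · simp [sl_lie_apply, slH]
    ring
  · simp [hij]

theorem eq_zero_of_fst_zero_zero_ne_zero (hx : x ∈ rootSpace a α) {j : Fin 3}
    (h : (x.1 j).1 0 0 ≠ 0) : α = 0 := by
  refine dual_ext fun i => ?_
  have hi := congrArg (fun y : Carrier K => (y.1 j).1 0 0) (mem_rootSpace_iff.1 hx i)
  rw [bracket_diagH_fst] at hi
  refine mul_right_cancel₀ h (hi.symm.trans ?_)
  obtain rfl | hij := eq_or_ne i j
  · simp [sl_lie_apply, slH]
  · simp [hij]

theorem eq_wt_of_snd_ne_zero (hx : x ∈ rootSpace a α) {p : Fin 3 → Fin 2}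
    (h : x.2 (p 0) (p 1) (p 2) ≠ 0) : α = wt fun i => (-1) ^ (p i : ℕ) := by
  refine dual_ext fun i => ?_
  have hi := congrArg (fun y : Carrier K => y.2 (p 0) (p 1) (p 2)) (mem_rootSpace_iff.1 hx i)
  rw [bracket_diagH_snd] at hi
  rw [wt_diagH]
  exact mul_right_cancel₀ h hi.symm

theorem snd_eq_zero_of_forall_ne (hx : x ∈ rootSpace a α)
    (h : ∀ p : Fin 3 → Fin 2, α ≠ wt fun i => (-1) ^ (p i : ℕ)) : x.2 = 0 := by
  ext p q r
  by_contra h0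
  exact h ![p, q, r] (eq_wt_of_snd_ne_zero hx (p := ![p, q, r]) h0)

theorem fst_eq_zero_of_forall_ne (hx : x ∈ rootSpace a α) (h0 : α ≠ 0)
    (h : ∀ (j : Fin 3) (s : ℤˣ), α ≠ wt (Pi.single j (2 * ((s : ℤ) : K)))) : x.1 = 0 := by
  refine funext fun j => sl_ext ?_ ?_ ?_
  · by_contra hne
    exact h0 (eq_zero_of_fst_zero_zero_ne_zero hx hne)
  · by_contra hne
    exact h j 1 (by simpa using eq_wt_single_of_fst_zero_one_ne_zero hx hne)
  · by_contra hne
    exact h j (-1) (by simpa using eq_wt_single_of_fst_one_zero_ne_zero hx hne)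

theorem exists_of_mem_evenRoots (h : α ∈ evenRoots a) :
    ∃ (j : Fin 3) (s : ℤˣ), α = wt (Pi.single j (2 * ((s : ℤ) : K))) := by
  obtain ⟨x, ⟨hx, hx₀⟩, hne⟩ := Submodule.exists_mem_ne_zero_of_ne_bot h.2
  by_contra! hcon
  exact hne (Prod.ext (fst_eq_zero_of_forall_ne hx h.1 hcon) (mem_part_zero.1 hx₀))

theorem exists_of_mem_oddRoots (h : α ∈ oddRoots a) :
    ∃ p : Fin 3 → Fin 2, α = wt fun i => (-1) ^ (p i : ℕ) := by
  obtain ⟨x, ⟨hx, hx₁⟩, hne⟩ := Submodule.exists_mem_ne_zero_of_ne_bot h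
  by_contra! hcon
  exact hne (Prod.ext (mem_part_one.1 hx₁) (snd_eq_zero_of_forall_ne hx hcon))

theorem exists_lie_slH_eq_smul (s : ℤˣ) :
    ∃ y : LieAlgebra.SpecialLinear.sl (Fin 2) K, ⁅slH K, y⁆ = (2 * ((s : ℤ) : K)) • y ∧ y ≠ 0 := by
  obtain rfl | rfl := Int.units_eq_one_or s
  · refine ⟨slE K, by simp [slH_E], fun h => ?_⟩
    simpa [slE] using congrArg (fun y => y.1 0 1) h
  · refine ⟨slF K, by simp [slH_F], fun h => ?_⟩
    simpa [slF] using congrArg (fun y => y.1 1 0) h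

theorem wt_single_mem_evenRoots [CharZero K] (a : K) (j : Fin 3) (s : ℤˣ) :
    wt (Pi.single j (2 * ((s : ℤ) : K))) ∈ evenRoots a := by
  refine ⟨fun h => ?_, ?_⟩
  · simpa using LinearMap.congr_fun h (diagH K j)
  · obtain ⟨y, hy, hy₀⟩ := exists_lie_slH_eq_smul (K := K) s
    refine (Submodule.ne_bot_iff _).2 ⟨inEven j y, ⟨?_, mem_part_zero.2 rfl⟩, fun h => hy₀ ?_⟩
    · rw [SetLike.mem_coe, mem_rootSpace_iff]
      intro i
      rw [wt_diagH, diagH, bracket_even]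
      obtain rfl | hij := eq_or_ne i j
      · simp [hy, inEven_smul]
      · simp [hij]
    · simpa [inEven] using congrArg (fun x : Carrier K => x.1 j) h

theorem wt_mem_oddRoots (a : K) (p : Fin 3 → Fin 2) :
    wt (fun i => (-1 : K) ^ (p i : ℕ)) ∈ oddRoots a := by
  refine (Submodule.ne_bot_iff _).2
    ⟨inOdd K (p 0) (p 1) (p 2), ⟨?_, mem_part_one.2 rfl⟩, fun h => ?_⟩
  · rw [SetLike.mem_coe, mem_rootSpace_iff]
    intro i
    refine Prod.ext ?_ (funext fun t => funext fun u => funext fun v => ?_)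
    · simp [bracket_apply, inOdd, diagH, inEven, evenBracket_zero_right, oddBracket_zero_left]
    · refine (bracket_diagH_snd a i _ ![t, u, v]).trans ?_
      rw [wt_diagH]
      by_cases h : t = p 0 ∧ u = p 1 ∧ v = p 2
      · obtain ⟨rfl, rfl, rfl⟩ := h
        fin_cases i <;> simp [inOdd]
      · simp [inOdd, h]
  · simpa [inOdd] using congrArg (fun x : Carrier K => x.2 (p 0) (p 1) (p 2)) h

theorem neg_mem_evenRoots [CharZero K] (h : α ∈ evenRoots a) : -α ∈ evenRoots a := by
  obtain ⟨j, s, rfl⟩ := exists_of_mem_evenRoots h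
  simpa [← map_neg, ← Pi.single_neg] using wt_single_mem_evenRoots a j (-s)

theorem disjoint_evenRoots_oddRoots [CharZero K] (a : K) :
    Disjoint (evenRoots a) (oddRoots a) := by
  refine Set.disjoint_left.2 fun α h h' => ?_
  obtain ⟨j, s, rfl⟩ := exists_of_mem_evenRoots h
  obtain ⟨p, hp⟩ := exists_of_mem_oddRoots h'
  have hj : j + 1 ≠ j := by simp
  refine pow_ne_zero (p (j + 1) : ℕ) (neg_ne_zero.2 (one_ne_zero (α := K))) ?_
  simpa [hj] using (LinearMap.congr_fun hp (diagH K (j + 1))).symm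

theorem ne_zero_of_mem_roots (h : α ∈ roots a) : α ≠ 0 := by
  rcases h with h | h
  · exact h.1
  · rintro rfl
    obtain ⟨p, hp⟩ := exists_of_mem_oddRoots h
    refine pow_ne_zero (p 0 : ℕ) (neg_ne_zero.2 (one_ne_zero (α := K))) ?_
    simpa using (LinearMap.congr_fun hp (diagH K 0)).symm

theorem rootSpace_le_part_zero [CharZero K] (h : α ∈ evenRoots a) :
    rootSpace a α ≤ part K 0 := fun _ hx =>
  mem_part_zero.2 <| snd_eq_zero_of_forall_ne hx fun p hp =>
    Set.disjoint_left.1 (disjoint_evenRoots_oddRoots a) h (hp ▸ wt_mem_oddRoots a p)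

theorem rootSpace_le_part_one [CharZero K] (h : α ∈ oddRoots a) :
    rootSpace a α ≤ part K 1 := fun _ hx =>
  mem_part_one.2 <| fst_eq_zero_of_forall_ne hx (ne_zero_of_mem_roots (Or.inr h)) fun j s hs =>
    Set.disjoint_left.1 (disjoint_evenRoots_oddRoots a) (hs ▸ wt_single_mem_evenRoots a j s) h

theorem sigma_ne_zero [CharZero K] (ha₀ : a ≠ 0) (ha₁ : a ≠ -1) (i : Fin 3) :
    sigma a i ≠ 0 := by
  have h : 1 + a ≠ 0 := fun h => ha₁ (eq_neg_of_add_eq_zero_right h)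
  fin_cases i
  · exact div_ne_zero (neg_ne_zero.2 h) two_ne_zero
  · exact one_div_ne_zero two_ne_zero
  · exact div_ne_zero ha₀ two_ne_zero

theorem intCast_units_mul_self (s : ℤˣ) : ((s : ℤ) : K) * (s : ℤ) = 1 := by
  rw [← Int.cast_mul, ← Units.val_mul, Int.units_mul_self, Units.val_one, Int.cast_one]

theorem form_wt (a : K) (c d : Fin 3 → K) : form a (wt c) (wt d) = ∑ i, sigma a i * c i * d i := by
  simp [form]

theorem coroot_wt_single [CharZero K] (ha₀ : a ≠ 0) (ha₁ : a ≠ -1) (j : Fin 3) (s : ℤˣ) :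
    coroot a (wt (Pi.single j (2 * ((s : ℤ) : K)))) = ((s : ℤ) : K) • diagH K j := by
  have hs := intCast_units_mul_self (K := K) s
  have hform : form a (wt (Pi.single j (2 * ((s : ℤ) : K)))) (wt (Pi.single j (2 * ((s : ℤ) : K))))
      = 4 * sigma a j := by
    rw [form_wt, Finset.sum_eq_single j (fun i _ hi => by simp [hi]) (by simp)]
    simp only [Pi.single_eq_same]
    linear_combination 4 * sigma a j * hs
  have hdual : dualVector a (wt (Pi.single j (2 * ((s : ℤ) : K)))) =
      (2 * (s : ℤ) * sigma a j) • diagH K j := by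
    rw [dualVector, Finset.sum_eq_single j (fun i _ hi => by simp [hi]) (by simp)]
    simp [mul_comm]
  have hσ := sigma_ne_zero ha₀ ha₁ j
  rw [coroot, hform, if_neg (mul_ne_zero (OfNat.ofNat_ne_zero 4) hσ), hdual, smul_smul]
  congr 1
  field_simp
  norm_num

theorem apply_coroot_self [CharZero K] (ha₀ : a ≠ 0) (ha₁ : a ≠ -1) (h : α ∈ evenRoots a) :
    α (coroot a α) = 2 := by
  obtain ⟨j, s, rfl⟩ := exists_of_mem_evenRoots h
  have hs := intCast_units_mul_self (K := K) s
  rw [coroot_wt_single ha₀ ha₁, map_smul, wt_diagH, Pi.single_eq_same, smul_eq_mul]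
  linear_combination 2 * hs

theorem form_self_of_mem_oddRoots [CharZero K] (h : α ∈ oddRoots a) : form a α α = 0 := by
  obtain ⟨p, rfl⟩ := exists_of_mem_oddRoots h
  simp [form_wt, mul_assoc, ← mul_pow, Fin.sum_univ_three, sigma]
  ring

theorem exists_oddRoot_add_mem_evenRoots [CharZero K] (h : α ∈ oddRoots a) :
    ∃ β ∈ oddRoots a, α + β ∈ evenRoots a ∧ β (coroot a α) = -1 := by
  have h0 := form_self_of_mem_oddRoots h
  obtain ⟨p, rfl⟩ := exists_of_mem_oddRoots h
  have hneg (t : Fin 2) : (-1 : K) ^ ((t + 1 : Fin 2) : ℕ) = -(-1) ^ (t : ℕ) := by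
    fin_cases t <;> simp
  refine ⟨wt fun i => (-1) ^ (![p 0 + 1, p 1, p 2 + 1] i : ℕ), wt_mem_oddRoots a _, ?_, ?_⟩
  · convert wt_single_mem_evenRoots a 1 ((-1) ^ (p 1 : ℕ)) using 1
    rw [← map_add]
    congr 1
    funext i
    fin_cases i <;> simp [hneg, two_mul]
  · rw [coroot, if_pos h0, map_neg, apply_dualVector, form_wt]
    simp [Fin.sum_univ_three, hneg, mul_assoc, ← mul_pow, sigma]
    field_simp
    ring

end Roots

end D21

namespace D21

section WeightSpaces

/-! ### The action on weight spaces -/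

attribute [local instance] LieRing.ofAssociativeRing

variable {K : Type*} [Field K] {a : K} {V : Type*} [AddCommGroup V] [Module K V]

theorem cartan_le_part_zero : cartan K ≤ part K 0 := by
  refine Submodule.span_le.2 ?_
  rintro _ ⟨i, rfl⟩
  exact mem_part_zero.2 rfl

theorem ChevalleyBasis.X_mem_rootSpace (B : ChevalleyBasis a) (α : roots a) :
    B.X α ∈ rootSpace a α := by
  rw [mem_rootSpace]
  intro H
  have hH : H ∈ Submodule.span K (Set.range B.H) := B.span_H ▸ Submodule.mem_top
  induction hH using Submodule.span_induction with
  | mem x hx =>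
    obtain ⟨i, rfl⟩ := hx
    exact B.bracket_H_X i α
  | zero => simp
  | add x y _ _ hx hy => simp [hx, hy, add_smul]
  | smul c x _ hx => simp [hx, smul_smul]

theorem diagH_mem_span [CharZero K] (ha₀ : a ≠ 0) (ha₁ : a ≠ -1) (B : ChevalleyBasis a)
    (i : Fin 3) : diagH K i ∈ Submodule.span (intAdjoin a) (Set.range B.H) := by
  rw [B.span_coroots]
  refine Submodule.subset_span ⟨_, Or.inl (wt_single_mem_evenRoots a i 1), ?_⟩
  rw [coroot_wt_single ha₀ ha₁, Units.val_one, Int.cast_one, one_smul]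

section Rep

variable [CharZero K] (ρ : LieSuperalgebra.Rep (algebra a) V)

theorem toHom_bracket_of_mem_part_zero {x y : Carrier K} (hx : x ∈ part K 0) {j : ZMod 2}
    (hy : y ∈ part K j) : ρ.toHom (bracket a x y) = ⁅ρ.toHom x, ρ.toHom y⁆ := by
  have h : ρ.toHom (bracket a x y) = _ := ρ.map_bracket 0 j x hx y hy
  simpa [superSign, Ring.lie_def] using h

theorem toHom_bracket_of_mem_part_one {x y : Carrier K} (hx : x ∈ part K 1) (hy : y ∈ part K 1) :
    ρ.toHom (bracket a x y) = ρ.toHom x * ρ.toHom y + ρ.toHom y * ρ.toHom x := by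
  have h : ρ.toHom (bracket a x y) = _ := ρ.map_bracket 1 1 x hx y hy
  simpa [superSign] using h

theorem toHom_apply_mem_weightSpace {α μ : Module.Dual K (cartan K)} {j : ZMod 2} {x : Carrier K}
    (hx : x ∈ rootSpace a α) (hj : x ∈ part K j) {v : V} (hv : v ∈ weightSpace ρ μ) :
    ρ.toHom x v ∈ weightSpace ρ (μ + α) := by
  rw [mem_weightSpace] at hv ⊢
  intro H
  have h := LinearMap.congr_fun
    (toHom_bracket_of_mem_part_zero ρ (cartan_le_part_zero H.2) hj) v
  rw [(mem_rootSpace a α x).1 hx H, map_smul, LinearMap.smul_apply, Ring.lie_def,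
    LinearMap.sub_apply, Module.End.mul_apply, Module.End.mul_apply, hv, map_smul,
    eq_sub_iff_add_eq] at h
  rw [← h, LinearMap.add_apply, add_smul, add_comm]

theorem isSl2Triple_toHom (ha₀ : a ≠ 0) (ha₁ : a ≠ -1) (B : ChevalleyBasis a)
    {α β : roots a} (hα : α.1 ∈ evenRoots a) (hβ : β.1 = -α.1)
    (h₀ : ρ.toHom (coroot a α : Carrier K) ≠ 0) :
    IsSl2Triple (ρ.toHom (coroot a α : Carrier K)) (ρ.toHom (B.X α)) (ρ.toHom (B.X β)) := by
  have hX {γ : roots a} (hγ : γ.1 ∈ evenRoots a) : B.X γ ∈ part K 0 :=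
    rootSpace_le_part_zero hγ (B.X_mem_rootSpace γ)
  have hβ' : β.1 ∈ evenRoots a := hβ ▸ neg_mem_evenRoots hα
  have hlie {γ : roots a} (hγ : γ.1 ∈ evenRoots a) :
      ⁅ρ.toHom (coroot a α : Carrier K), ρ.toHom (B.X γ)⁆ =
        γ.1 (coroot a α) • ρ.toHom (B.X γ) := by
    rw [← toHom_bracket_of_mem_part_zero ρ (cartan_le_part_zero (coroot a α).2) (hX hγ),
      (mem_rootSpace a γ _).1 (B.X_mem_rootSpace γ), map_smul]
  refine ⟨h₀, ?_, ?_, ?_⟩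
  · rw [← toHom_bracket_of_mem_part_zero ρ (hX hα) (hX hβ'), B.bracket_X_neg α β hβ fun h =>
      Set.disjoint_left.1 (disjoint_evenRoots_oddRoots a) hα h.1]
  · rw [hlie hα, apply_coroot_self ha₀ ha₁ hα, ofNat_smul_eq_nsmul]
  · rw [hlie hβ', hβ, LinearMap.neg_apply, apply_coroot_self ha₀ ha₁ hα, neg_smul,
      ofNat_smul_eq_nsmul]

variable {ρ}

theorem weightSpace_eq_bot {μ : Module.Dual K (cartan K)} (hμ : μ ∉ weights ρ) :
    weightSpace ρ μ = ⊥ := by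
  rwa [weights, Set.mem_ofPred_eq, not_not] at hμ

theorem end_ext_of_weightSpace (hV : ⨆ μ, weightSpace ρ μ = ⊤) {S T : Module.End K V}
    (h : ∀ μ ∈ weights ρ, ∀ v ∈ weightSpace ρ μ, S v = T v) : S = T := by
  refine LinearMap.eqLocus_eq_top.1 (top_unique (hV.ge.trans (iSup_le fun μ => ?_)))
  by_cases hμ : μ ∈ weights ρ
  · exact h μ hμ
  · rw [weightSpace_eq_bot hμ]
    exact bot_le

theorem hasEigenvalue_toHom {μ : Module.Dual K (cartan K)} (hμ : μ ∈ weights ρ) (H : cartan K) :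
    (ρ.toHom (H : Carrier K)).HasEigenvalue (μ H) := by
  obtain ⟨v, hv, hv₀⟩ := Submodule.exists_mem_ne_zero_of_ne_bot hμ
  exact Module.End.hasEigenvalue_of_hasEigenvector
    ⟨Module.End.mem_eigenspace_iff.2 ((mem_weightSpace ρ μ v).1 hv H), hv₀⟩

variable (ρ) in
theorem finite_weights [FiniteDimensional K V] : (weights ρ).Finite := by
  refine Set.Finite.of_finite_image (f := fun μ i => μ (diagH K i)) ?_
    fun μ _ ν _ h => dual_ext fun i => congrFun h i
  refine (Set.Finite.pi' (t := fun i => {c | Module.End.HasEigenvalue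
    (ρ.toHom (diagH K i : Carrier K)) c}) fun i => Module.End.finite_hasEigenvalue _).subset ?_
  rintro _ ⟨μ, hμ, rfl⟩ i
  exact hasEigenvalue_toHom hμ _

theorem exists_weight_apply_eq_of_hasEigenvalue [FiniteDimensional K V]
    (hV : ⨆ μ, weightSpace ρ μ = ⊤) {H : cartan K} {c : K}
    (hc : (ρ.toHom (H : Carrier K)).HasEigenvalue c) : ∃ μ ∈ weights ρ, μ H = c := by
  obtain ⟨v, hv⟩ := hc.exists_hasEigenvector
  let p : Polynomial K := ∏ μ ∈ (finite_weights ρ).toFinset, (.X - .C (μ H))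
  have hp : Polynomial.aeval (ρ.toHom (H : Carrier K)) p = 0 := by
    refine end_ext_of_weightSpace hV fun μ hμ w hw => ?_
    rw [Module.End.aeval_apply_of_mem_apply_eq_smul ((mem_weightSpace ρ μ w).1 hw H),
      Polynomial.eval_prod, Finset.prod_eq_zero (i := μ) (by simpa using hμ) (by simp), zero_smul,
      LinearMap.zero_apply]
  have hpc : p.eval c = 0 := by
    have h := Module.End.aeval_apply_of_hasEigenvector (p := p) hv
    rw [hp, LinearMap.zero_apply] at h
    exact (smul_eq_zero.1 h.symm).resolve_right hv.2
  rw [Polynomial.eval_prod, Finset.prod_eq_zero_iff] at hpc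
  obtain ⟨μ, hμ, h⟩ := hpc
  exact ⟨μ, by simpa using hμ, (sub_eq_zero.1 (by simpa using h)).symm⟩

theorem exists_weight_apply_ne_zero (hρ : Function.Injective ρ.toHom)
    (hV : ⨆ μ, weightSpace ρ μ = ⊤) {H : cartan K} (hH : H ≠ 0) : ∃ μ ∈ weights ρ, μ H ≠ 0 := by
  by_contra! hcon
  refine hH (Subtype.ext (hρ ?_))
  rw [ZeroMemClass.coe_zero, map_zero]
  refine end_ext_of_weightSpace hV fun μ hμ v hv => ?_
  rw [(mem_weightSpace ρ μ v).1 hv, hcon μ hμ, zero_smul, LinearMap.zero_apply]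

theorem exists_int_apply_coroot [FiniteDimensional K V] (ha₀ : a ≠ 0) (ha₁ : a ≠ -1)
    (B : ChevalleyBasis a) {μ α : Module.Dual K (cartan K)} (hμ : μ ∈ weights ρ)
    (hα : α ∈ evenRoots a) : ∃ n : ℤ, μ (coroot a α) = n := by
  have hc := hasEigenvalue_toHom hμ (coroot a α)
  by_cases h₀ : ρ.toHom (coroot a α : Carrier K) = 0
  · obtain ⟨v, hv⟩ := hc.exists_hasEigenvector
    have hv' := hv.apply_eq_smul
    rw [h₀, LinearMap.zero_apply, eq_comm, smul_eq_zero] at hv'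
    exact ⟨0, by rw [hv'.resolve_right hv.2, Int.cast_zero]⟩
  · exact exists_int_eq_of_hasEigenvalue (isSl2Triple_toHom ρ ha₀ ha₁ B (α := ⟨α, Or.inl hα⟩)
      (β := ⟨-α, Or.inl (neg_mem_evenRoots hα)⟩) hα rfl h₀) hc

theorem exists_int_apply_diagH [FiniteDimensional K V] (ha₀ : a ≠ 0) (ha₁ : a ≠ -1)
    (B : ChevalleyBasis a) {μ : Module.Dual K (cartan K)} (hμ : μ ∈ weights ρ) (i : Fin 3) :
    ∃ n : ℤ, μ (diagH K i) = n := by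
  have h := exists_int_apply_coroot ha₀ ha₁ B hμ (wt_single_mem_evenRoots a i 1)
  rwa [coroot_wt_single ha₀ ha₁, Units.val_one, Int.cast_one, one_smul] at h

end Rep

end WeightSpaces

end D21

namespace D21

section WeightProjections

/-! ### Weight projections preserve admissible lattices -/

variable {K : Type*} [Field K] [CharZero K] {a : K} {V : Type*} [AddCommGroup V] [Module K V]
  {ρ : LieSuperalgebra.Rep (algebra a) V} {B : ChevalleyBasis a} {M : Submodule (binomRing a) V}
  {μ : Module.Dual K (cartan K)} {e T : Module.End K V}

theorem IsAdmissible.envAction_mem (hM : IsAdmissible B ρ M)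
    {u : LieSuperalgebra.Env (algebra a)} (hu : u ∈ kostant B) : ρ.envAction u ∈ latticeEnd M :=
  hM.stable u hu

theorem IsAdmissible.binomCoeff_mem (hM : IsAdmissible B ρ M) {H : cartan K}
    (hH : H ∈ Submodule.span (intAdjoin a) (Set.range B.H)) (n : ℕ) :
    binomCoeff K (ρ.toHom (H : Carrier K)) n ∈ latticeEnd M := by
  rw [← ρ.envAction_of, ← map_binomCoeff]
  exact hM.envAction_mem (Algebra.subset_adjoin (Or.inr ⟨H, hH, n, rfl⟩))

theorem IsAdmissible.dividedPow_mem (hM : IsAdmissible B ρ M) {α : roots a}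
    (hα : α.1 ∈ evenRoots a) (n : ℕ) : dividedPow K (ρ.toHom (B.X α)) n ∈ latticeEnd M := by
  rw [← ρ.envAction_of, ← map_dividedPow]
  exact hM.envAction_mem (Algebra.subset_adjoin (Or.inl (Or.inl ⟨α, hα, n, rfl⟩)))

theorem IsAdmissible.toHom_X_mem (hM : IsAdmissible B ρ M) (α : roots a) :
    ρ.toHom (B.X α) ∈ latticeEnd M := by
  rcases α.2 with hα | hα
  · simpa [dividedPow] using hM.dividedPow_mem hα 1
  · rw [← ρ.envAction_of]
    exact hM.envAction_mem (Algebra.subset_adjoin (Or.inl (Or.inr ⟨α, hα, rfl⟩)))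

/-- `e` is the projection of `V` onto the weight space `V_μ` along the other weight spaces. It is
determined by this property when `V` is the sum of its weight spaces. -/
def IsWeightProjection (ρ : LieSuperalgebra.Rep (algebra a) V) (μ : Module.Dual K (cartan K))
    (e : Module.End K V) : Prop :=
  (∀ v ∈ weightSpace ρ μ, e v = v) ∧ ∀ ν ≠ μ, ∀ v ∈ weightSpace ρ ν, e v = 0

open scoped Classical in
theorem exists_integerValued_eval_weight [FiniteDimensional K V] (ha₀ : a ≠ 0) (ha₁ : a ≠ -1)
    (B : ChevalleyBasis a) (ρ : LieSuperalgebra.Rep (algebra a) V) (i : Fin 3) (c : K) :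
    ∃ f ∈ integerValued K, ∀ ν ∈ weights ρ,
      f.eval (ν (diagH K i)) = if ν (diagH K i) = c then 1 else 0 := by
  by_cases hc : ∃ k : ℤ, c = k
  · obtain ⟨k, rfl⟩ := hc
    have hF := ((finite_weights ρ).image fun ν => ν (diagH K i)).preimage
      (f := ((↑) : ℤ → K)) Int.cast_injective.injOn
    obtain ⟨f, hf, hfF⟩ := exists_integerValued_indicator (K := K) hF k
    refine ⟨f, hf, fun ν hν => ?_⟩
    obtain ⟨n, hn⟩ := exists_int_apply_diagH ha₀ ha₁ B hν i
    rw [hn, hfF n ⟨ν, hν, hn⟩]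
    simp only [Int.cast_inj]
  · refine ⟨0, zero_mem _, fun ν hν => ?_⟩
    rw [Polynomial.eval_zero, if_neg]
    rintro rfl
    exact hc (exists_int_apply_diagH ha₀ ha₁ B hν i)

theorem IsAdmissible.exists_isWeightProjection [FiniteDimensional K V] (ha₀ : a ≠ 0)
    (ha₁ : a ≠ -1) (hM : IsAdmissible B ρ M) (μ : Module.Dual K (cartan K)) :
    ∃ e ∈ latticeEnd M, IsWeightProjection ρ μ e := by
  classical
  choose f hf hfw using fun i => exists_integerValued_eval_weight ha₀ ha₁ B ρ i (μ (diagH K i))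
  let E (i : Fin 3) : Module.End K V := Polynomial.aeval (ρ.toHom (diagH K i : Carrier K)) (f i)
  have hE (i : Fin 3) : E i ∈ latticeEnd M :=
    aeval_mem_of_mem_integerValued (hM.binomCoeff_mem (diagH_mem_span ha₀ ha₁ B i)) (hf i)
  have hEw {ν : Module.Dual K (cartan K)} {v : V} (hv : v ∈ weightSpace ρ ν) (i : Fin 3) :
      E i v = (f i).eval (ν (diagH K i)) • v :=
    Module.End.aeval_apply_of_mem_apply_eq_smul ((mem_weightSpace ρ ν v).1 hv _)
  have hprod (ν : Module.Dual K (cartan K)) (v : V) (hv : v ∈ weightSpace ρ ν) :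
      (E 0 * E 1 * E 2) v = if ν = μ then v else 0 := by
    by_cases hν : ν ∈ weights ρ
    · have hiff : ν = μ ↔ ∀ i, ν (diagH K i) = μ (diagH K i) :=
        ⟨fun h i => h ▸ rfl, dual_ext⟩
      simp only [Module.End.mul_apply, hEw hv, map_smul, hfw _ ν hν, hiff, Fin.forall_fin_succ]
      split_ifs <;> simp_all
    · rw [weightSpace_eq_bot hν, Submodule.mem_bot] at hv
      simp [hv]
  exact ⟨_, mul_mem (mul_mem (hE 0) (hE 1)) (hE 2), fun v hv => by rw [hprod μ v hv, if_pos rfl],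
    fun ν hν v hv => by rw [hprod ν v hv, if_neg hν]⟩

theorem IsWeightProjection.mul_eq_smul (hV : ⨆ μ, weightSpace ρ μ = ⊤)
    (he : IsWeightProjection ρ μ e) {c : K} (h : ∀ v ∈ weightSpace ρ μ, T v = c • v) :
    T * e = c • e := by
  refine end_ext_of_weightSpace hV fun ν _ v hv => ?_
  rw [Module.End.mul_apply, LinearMap.smul_apply]
  obtain rfl | hν := eq_or_ne ν μ
  · rw [he.1 v hv, h v hv]
  · rw [he.2 ν hν v hv, map_zero, smul_zero]

theorem IsWeightProjection.isIdempotentElem (hV : ⨆ μ, weightSpace ρ μ = ⊤)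
    (he : IsWeightProjection ρ μ e) : IsIdempotentElem e := by
  simpa [IsIdempotentElem] using he.mul_eq_smul hV (c := 1) fun v hv => by rw [he.1 v hv, one_smul]

theorem IsWeightProjection.ne_zero (he : IsWeightProjection ρ μ e) (hμ : μ ∈ weights ρ) :
    e ≠ 0 := by
  obtain ⟨v, hv, hv₀⟩ := Submodule.exists_mem_ne_zero_of_ne_bot hμ
  rintro rfl
  exact hv₀ (he.1 v hv).symm

variable [FiniteDimensional K V]

theorem IsAdmissible.mem_binomRing_of_apply_eq_smul (ha₀ : a ≠ 0) (ha₁ : a ≠ -1)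
    (hV : ⨆ μ, weightSpace ρ μ = ⊤) (hM : IsAdmissible B ρ M) (hμ : μ ∈ weights ρ)
    (hT : T ∈ latticeEnd M) {c : K} (h : ∀ v ∈ weightSpace ρ μ, T v = c • v) :
    c ∈ binomRing a := by
  obtain ⟨e, heM, he⟩ := hM.exists_isWeightProjection ha₀ ha₁ μ
  exact hM.isLattice.mem_of_smul_mem_latticeEnd (he.isIdempotentElem hV) (he.ne_zero hμ) heM
    (he.mul_eq_smul hV h ▸ mul_mem hT heM)

theorem IsAdmissible.component_mem_latticeEnd (ha₀ : a ≠ 0) (ha₁ : a ≠ -1)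
    (hV : ⨆ μ, weightSpace ρ μ = ⊤) (hM : IsAdmissible B ρ M) {ι : Type*} [Fintype ι]
    {Z : ι → Module.End K V} {β : ι → Module.Dual K (cartan K)} (hβ : Function.Injective β)
    (hZ : ∀ i μ, ∀ v ∈ weightSpace ρ μ, Z i v ∈ weightSpace ρ (μ + β i))
    (h : ∑ i, Z i ∈ latticeEnd M) (i : ι) : Z i ∈ latticeEnd M := by
  choose e heM he using hM.exists_isWeightProjection ha₀ ha₁
  have key : Z i = ∑ μ ∈ (finite_weights ρ).toFinset, e (μ + β i) * (∑ j, Z j) * e μ := by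
    refine end_ext_of_weightSpace hV fun ν hν v hv => ?_
    rw [LinearMap.sum_apply, Finset.sum_eq_single ν]
    · rw [Module.End.mul_apply, Module.End.mul_apply, (he ν).1 v hv, LinearMap.sum_apply, map_sum,
        Finset.sum_eq_single i, (he _).1 _ (hZ i ν v hv)]
      · exact fun j _ hj => (he _).2 _ (fun h => hj (hβ (add_left_cancel h))) _ (hZ j ν v hv)
      · simp
    · intro μ _ hμ
      rw [Module.End.mul_apply, (he μ).2 ν hμ.symm v hv, map_zero]
    · simp [hν]
  rw [key]
  exact sum_mem fun μ _ => mul_mem (mul_mem (heM _) h) (heM _)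

theorem IsAdmissible.toHom_cartan_mem_latticeEnd_iff (ha₀ : a ≠ 0) (ha₁ : a ≠ -1)
    (hV : ⨆ μ, weightSpace ρ μ = ⊤) (hM : IsAdmissible B ρ M) (H : cartan K) :
    ρ.toHom (H : Carrier K) ∈ latticeEnd M ↔ ∀ μ ∈ weights ρ, μ H ∈ binomRing a := by
  refine ⟨fun h μ hμ => hM.mem_binomRing_of_apply_eq_smul ha₀ ha₁ hV hμ h fun v hv =>
    (mem_weightSpace ρ μ v).1 hv H, fun h => ?_⟩
  choose e heM he using hM.exists_isWeightProjection ha₀ ha₁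
  have key : ρ.toHom (H : Carrier K) = ∑ μ ∈ (finite_weights ρ).toFinset, μ H • e μ := by
    refine end_ext_of_weightSpace hV fun ν hν v hv => ?_
    rw [LinearMap.sum_apply, Finset.sum_eq_single ν, LinearMap.smul_apply, (he ν).1 v hv,
      (mem_weightSpace ρ ν v).1 hv]
    · intro μ _ hμ
      rw [LinearMap.smul_apply, (he μ).2 ν hμ.symm v hv, smul_zero]
    · simp [hν]
  rw [key]
  exact sum_mem fun μ hμ => smul_mem_latticeEnd (h μ (by simpa using hμ)) (heM μ)

end WeightProjections

end D21

namespace D21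

section RootVectors

/-! ### Coefficients of root vectors preserving a lattice -/

attribute [local instance] LieRing.ofAssociativeRing

variable {K : Type*} [Field K] [CharZero K] {a : K} {V : Type*} [AddCommGroup V] [Module K V]
  [FiniteDimensional K V] {ρ : LieSuperalgebra.Rep (algebra a) V} {B : ChevalleyBasis a}
  {M : Submodule (binomRing a) V} {α : roots a} {c : K}

theorem toHom_coroot_ne_zero {V : Type*} [AddCommGroup V] [Module K V]
    {ρ : LieSuperalgebra.Rep (algebra a) V} (ha₀ : a ≠ 0) (ha₁ : a ≠ -1)
    (hρ : Function.Injective ρ.toHom) {α : Module.Dual K (cartan K)} (hα : α ∈ evenRoots a) :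
    ρ.toHom (coroot a α : Carrier K) ≠ 0 := fun h => by
  have h₀ : coroot a α = 0 := Subtype.ext (hρ (h.trans (map_zero _).symm))
  have h₂ := apply_coroot_self ha₀ ha₁ hα
  rw [h₀, map_zero] at h₂
  exact two_ne_zero h₂.symm

theorem exists_highest_weight_of_mem_evenRoots (ha₀ : a ≠ 0) (ha₁ : a ≠ -1)
    (B : ChevalleyBasis a) (hρ : Function.Injective ρ.toHom) (hV : ⨆ μ, weightSpace ρ μ = ⊤)
    {α : Module.Dual K (cartan K)} (hα : α ∈ evenRoots a) :
    ∃ μ ∈ weights ρ, ∃ m : ℕ, m ≠ 0 ∧ μ (coroot a α) = m ∧ μ + α ∉ weights ρ := by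
  let S : Set ℕ := (↑) ⁻¹' ((fun μ => μ (coroot a α)) '' weights ρ)
  have hS : S.Finite := ((finite_weights ρ).image _).preimage Nat.cast_injective.injOn
  obtain ⟨m₀, hm₀, hm₀S⟩ : ∃ m₀ : ℕ, 0 < m₀ ∧ m₀ ∈ S := by
    have h₀ := toHom_coroot_ne_zero ha₀ ha₁ hρ hα
    obtain ⟨μ, hμ, hμ₀⟩ := exists_weight_apply_ne_zero hρ hV (H := coroot a α)
      fun h => h₀ (by rw [h, ZeroMemClass.coe_zero, map_zero])
    obtain ⟨m, hm, hmh⟩ := exists_pos_hasEigenvalue (isSl2Triple_toHom ρ ha₀ ha₁ B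
      (α := ⟨α, Or.inl hα⟩) (β := ⟨-α, Or.inl (neg_mem_evenRoots hα)⟩) hα rfl h₀)
      (hasEigenvalue_toHom hμ _) hμ₀
    exact ⟨m, hm, exists_weight_apply_eq_of_hasEigenvalue hV hmh⟩
  obtain ⟨m, ⟨μ, hμ, hm : μ (coroot a α) = m⟩, hmax⟩ := Set.exists_max_image S id hS ⟨m₀, hm₀S⟩
  refine ⟨μ, hμ, m, (hm₀.trans_le (hmax m₀ hm₀S)).ne', hm, fun h => ?_⟩
  have hm₂ : m + 2 ∈ S := by
    refine ⟨_, h, ?_⟩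
    simp only [LinearMap.add_apply, hm, apply_coroot_self ha₀ ha₁ hα, Nat.cast_add, Nat.cast_ofNat]
  exact absurd (hmax _ hm₂) (by simp)

theorem isRadical_natCast_binomRing (a : K) {p : ℕ} (hp : p.Prime) :
    IsRadical (p : binomRing a) :=
  isRadical_natCast_closure_binomCoeff (intAdjoin a : Set K) hp

theorem IsAdmissible.mem_binomRing_of_smul_mem_of_mem_evenRoots (ha₀ : a ≠ 0) (ha₁ : a ≠ -1)
    (hρ : Function.Injective ρ.toHom) (hV : ⨆ μ, weightSpace ρ μ = ⊤) (hM : IsAdmissible B ρ M)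
    (hα : α.1 ∈ evenRoots a) (hc : c • ρ.toHom (B.X α) ∈ latticeEnd M) : c ∈ binomRing a := by
  let β : roots a := ⟨-α.1, Or.inl (neg_mem_evenRoots hα)⟩
  have hβ : β.1 ∈ evenRoots a := neg_mem_evenRoots hα
  have t := isSl2Triple_toHom ρ ha₀ ha₁ B hα (β := β) rfl (toHom_coroot_ne_zero ha₀ ha₁ hρ hα)
  obtain ⟨μ, hμ, m, hm₀, hm, hμα⟩ := exists_highest_weight_of_mem_evenRoots ha₀ ha₁ B hρ hV hα
  have hprim {v : V} (hv : v ∈ weightSpace ρ μ) (hv₀ : v ≠ 0) :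
      t.HasPrimitiveVectorWith v (m : K) := by
    refine ⟨hv₀, ?_, ?_⟩
    · exact hm ▸ (mem_weightSpace ρ μ v).1 hv _
    · have := toHom_apply_mem_weightSpace ρ (B.X_mem_rootSpace α)
        (rootSpace_le_part_zero hα (B.X_mem_rootSpace α)) hv
      rwa [weightSpace_eq_bot hμα, Submodule.mem_bot] at this
  refine mem_of_natCast_mul_mem (fun p => isRadical_natCast_binomRing a) hm₀ hm₀ ?_ ?_
  · have hbr : ⁅c • ρ.toHom (B.X α), ρ.toHom (B.X β)⁆ ∈ latticeEnd M :=
      sub_mem (mul_mem hc (hM.toHom_X_mem β)) (mul_mem (hM.toHom_X_mem β) hc)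
    refine hM.mem_binomRing_of_apply_eq_smul ha₀ ha₁ hV hμ hbr fun v hv => ?_
    rw [Ring.lie_def, smul_mul_assoc, mul_smul_comm, ← smul_sub, ← Ring.lie_def, t.lie_e_f,
      LinearMap.smul_apply, (mem_weightSpace ρ μ v).1 hv, hm, smul_smul, mul_comm]
  · refine hM.mem_binomRing_of_apply_eq_smul ha₀ ha₁ hV hμ
      (mul_mem (pow_mem hc m) (hM.dividedPow_mem hβ m)) fun v hv => ?_
    obtain rfl | hv₀ := eq_or_ne v 0
    · rw [map_zero, smul_zero]
    · rw [dividedPow, smul_pow, smul_mul_smul_comm, LinearMap.smul_apply,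
        pow_mul_pow_apply_of_hasPrimitiveVectorWith (hprim hv hv₀), smul_smul, mul_assoc,
        inv_mul_cancel_left₀ (Nat.cast_ne_zero.2 m.factorial_ne_zero)]

theorem IsAdmissible.mem_binomRing_of_smul_mem (ha₀ : a ≠ 0) (ha₁ : a ≠ -1)
    (hρ : Function.Injective ρ.toHom) (hV : ⨆ μ, weightSpace ρ μ = ⊤) (hM : IsAdmissible B ρ M)
    (hc : c • ρ.toHom (B.X α) ∈ latticeEnd M) : c ∈ binomRing a := by
  obtain hα | hα := α.2
  · exact hM.mem_binomRing_of_smul_mem_of_mem_evenRoots ha₀ ha₁ hρ hV hα hc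
  obtain ⟨β, hβ, hαβ, hval⟩ := exists_oddRoot_add_mem_evenRoots hα
  let β' : roots a := ⟨β, Or.inr hβ⟩
  let δ : roots a := ⟨α.1 + β, Or.inl hαβ⟩
  have hbr : bracket a (B.X α) (B.X β') = B.X δ ∨ bracket a (B.X α) (B.X β') = -B.X δ := by
    have h := B.bracket_X_X' α β' δ hαβ.1 rfl (form_self_of_mem_oddRoots hα)
      (form_self_of_mem_oddRoots hβ)
    rw [show β'.1 (coroot a α.1) = -1 from hval, neg_smul, one_smul, neg_neg] at h
    exact h.symm
  have hβM := hM.toHom_X_mem β'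
  have hmem : c • ρ.toHom (bracket a (B.X α) (B.X β')) ∈ latticeEnd M := by
    rw [toHom_bracket_of_mem_part_one ρ (rootSpace_le_part_one hα (B.X_mem_rootSpace α))
      (rootSpace_le_part_one hβ (B.X_mem_rootSpace β')), smul_add, ← smul_mul_assoc,
      ← mul_smul_comm]
    exact add_mem (mul_mem hc hβM) (mul_mem hβM hc)
  refine hM.mem_binomRing_of_smul_mem_of_mem_evenRoots ha₀ ha₁ hρ hV (α := δ) hαβ ?_
  obtain h | h := hbr
  · exact h ▸ hmem
  · rw [h, map_neg, smul_neg] at hmem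
    exact neg_mem_iff.1 hmem

end RootVectors

end D21

section IntegralBases

variable {K E ι : Type*} [Field K] [AddCommGroup E] [Module K E]

theorem forall_mem_span_int_apply_mem_iff {R : Subring K} {s : Set (Module.Dual K E)} {x : E} :
    (∀ μ ∈ Submodule.span ℤ s, μ x ∈ R) ↔ ∀ μ ∈ s, μ x ∈ R :=
  ⟨fun h μ hμ => h μ (Submodule.subset_span hμ), fun h _ hμ =>
    Submodule.span_induction h (by simp) (fun _ _ _ _ => add_mem) (fun z _ _ h => zsmul_mem h z) hμ⟩

variable [CharZero K] [Finite ι]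

theorem exists_basis_span_int_eq (e : Module.Basis ι K E) {s : Set E}
    (hs : Submodule.span K s = ⊤) (hse : s ⊆ Submodule.span ℤ (Set.range e)) :
    ∃ (n : ℕ) (b : Module.Basis (Fin n) K E),
      Submodule.span ℤ (Set.range b) = Submodule.span ℤ s := by
  cases nonempty_fintype ι
  obtain ⟨n, c⟩ := Submodule.basisOfPidOfLE (Submodule.span_le.2 hse) (e.restrictScalars ℤ)
  let b : Fin n → E := fun j => c j
  have hb : Submodule.span ℤ (Set.range b) = Submodule.span ℤ s := by
    have h := congrArg (Submodule.map (Submodule.span ℤ s).subtype) c.span_eq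
    rwa [Submodule.map_span, ← Set.range_comp, Submodule.map_subtype_top] at h
  have hspan : Submodule.span K (Set.range b) = ⊤ := by
    rw [← Submodule.span_span_of_tower ℤ, hb, Submodule.span_span_of_tower, hs]
  have := Module.Finite.of_basis e
  have hn : Fintype.card (Fin n) = Module.finrank K E := by
    refine le_antisymm ?_ (finrank_le_of_span_eq_top hspan)
    have := Module.Finite.of_basis (e.restrictScalars ℤ)
    rw [← Module.finrank_eq_card_basis c, Module.finrank_eq_card_basis e,
      ← Module.finrank_eq_card_basis (e.restrictScalars ℤ)]
    exact Submodule.finrank_mono (Submodule.span_le.2 hse)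
  refine ⟨n, basisOfTopLeSpanOfCardEqFinrank b hspan.ge hn, ?_⟩
  rw [coe_basisOfTopLeSpanOfCardEqFinrank, hb]

theorem exists_basis_forall_apply_mem_iff_repr_mem (e : Module.Basis ι K E)
    {s : Set (Module.Dual K E)} (hs : Submodule.span K s = ⊤)
    (hse : ∀ μ ∈ s, ∀ i, ∃ n : ℤ, μ (e i) = n) (R : Subring K) :
    ∃ (n : ℕ) (d : Module.Basis (Fin n) K E),
      ∀ x, (∀ μ ∈ s, μ x ∈ R) ↔ ∀ i, d.repr x i ∈ R := by
  classical
  have hfin := Module.Finite.of_basis e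
  have hse' : s ⊆ Submodule.span ℤ (Set.range e.dualBasis) := fun μ hμ => by
    refine (e.dualBasis.mem_span_iff_repr_mem ℤ μ).2 fun i => ?_
    obtain ⟨n, hn⟩ := hse μ hμ i
    exact ⟨n, by rw [e.dualBasis_repr, hn, eq_intCast]⟩
  obtain ⟨n, b, hb⟩ := exists_basis_span_int_eq e.dualBasis hs hse'
  let d := b.dualBasis.map (Module.evalEquiv K E).symm
  have hd (x : E) (i : Fin n) : d.repr x i = b i x := by
    simp [d]
  refine ⟨n, d, fun x => ?_⟩
  rw [← forall_mem_span_int_apply_mem_iff, ← hb, forall_mem_span_int_apply_mem_iff,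
    Set.forall_mem_range]
  simp only [hd]

end IntegralBases

namespace D21

section CartanStabilizer

variable {K : Type*} [Field K] [CharZero K] {a : K} {V : Type*} [AddCommGroup V] [Module K V]
  {ρ : LieSuperalgebra.Rep (algebra a) V}

/-! ### The lattice `h_V` -/

theorem span_weights_eq_top (hρ : Function.Injective ρ.toHom) (hV : ⨆ μ, weightSpace ρ μ = ⊤) :
    Submodule.span K (weights ρ) = ⊤ := by
  have hco : (Submodule.span K (weights ρ)).dualCoannihilator = ⊥ := by
    rw [Submodule.eq_bot_iff]
    intro H hH
    by_contra h₀
    obtain ⟨μ, hμ, hne⟩ := exists_weight_apply_ne_zero hρ hV h₀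
    exact hne ((Submodule.mem_dualCoannihilator H).1 hH μ (Submodule.subset_span hμ))
  rw [← Subspace.dualCoannihilator_dualAnnihilator_eq (W := Submodule.span K (weights ρ)), hco,
    Submodule.dualAnnihilator_bot]

theorem exists_basis_cartanStabilizer_eq_span [FiniteDimensional K V] (ha₀ : a ≠ 0) (ha₁ : a ≠ -1)
    (B : ChevalleyBasis a) (hρ : Function.Injective ρ.toHom) (hV : ⨆ μ, weightSpace ρ μ = ⊤) :
    ∃ (n : ℕ) (d : Module.Basis (Fin n) K (cartan K)), cartanStabilizer ρ =
      Submodule.span (binomRing a) (Set.range fun i => (d i : Carrier K)) := by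
  obtain ⟨n, d, hd⟩ := exists_basis_forall_apply_mem_iff_repr_mem (cartanBasis K)
    (span_weights_eq_top hρ hV)
    (fun μ hμ i => cartanBasis_apply (K := K) i ▸ exists_int_apply_diagH ha₀ ha₁ B hμ i)
    (binomRing a)
  refine ⟨n, d, Submodule.ext fun x => ?_⟩
  have hspan : Submodule.span (binomRing a) (Set.range fun i => (d i : Carrier K)) =
      (Submodule.span (binomRing a) (Set.range d)).map
        ((cartan K).subtype.restrictScalars (binomRing a)) := by
    rw [Submodule.map_span, ← Set.range_comp]
    rfl
  rw [hspan, Submodule.mem_map]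
  refine exists_congr fun H => ?_
  rw [and_comm, d.mem_span_iff_repr_mem (binomRing a), hd]
  simp [Algebra.algebraMap_ofSubring]

end CartanStabilizer

end D21

theorem iSupIndep_of_repr_eq_zero {R K E ι κ : Type*} [CommRing R] [CommRing K] [Algebra R K]
    [AddCommGroup E] [Module K E] [Module R E] [IsScalarTower R K E] (b : Module.Basis ι K E)
    (g : ι → κ) {N : κ → Submodule R E}
    (hN : ∀ k, ∀ x ∈ N k, ∀ j, g j ≠ k → b.repr x j = 0) : iSupIndep N := by
  intro k
  rw [Submodule.disjoint_def]
  intro x hx hx'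
  refine b.repr.map_eq_zero_iff.1 (Finsupp.ext fun j => ?_)
  by_cases hj : g j = k
  · have hle : ⨆ (l) (_ : l ≠ k), N l ≤ (LinearMap.ker (b.coord j)).restrictScalars R :=
      iSup₂_le fun l hl y hy => hN l y hy j (hj ▸ hl.symm)
    exact hle hx'
  · exact hN k x hx j hj

namespace D21

section Stabilizer

variable {K : Type*} [Field K] {a : K}

/-! ### The stabilizer of an admissible lattice -/

/-- The `K`-basis of `D(2,1;a)` formed by the elements of a Chevalley basis. -/
def ChevalleyBasis.basis (B : ChevalleyBasis a) : Module.Basis (Fin 3 ⊕ roots a) K (Carrier K) :=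
  Module.Basis.mk B.linearIndependent B.span_eq_top.ge

theorem ChevalleyBasis.basis_inl (B : ChevalleyBasis a) (i : Fin 3) :
    B.basis (Sum.inl i) = B.H i :=
  Module.Basis.mk_apply _ _ _

theorem ChevalleyBasis.basis_inr (B : ChevalleyBasis a) (α : roots a) :
    B.basis (Sum.inr α) = B.X α :=
  Module.Basis.mk_apply _ _ _

theorem ChevalleyBasis.repr_cartan_inr (B : ChevalleyBasis a) (H : cartan K) (α : roots a) :
    B.basis.repr (H : Carrier K) (Sum.inr α) = 0 := by
  have h : B.basis.coord (Sum.inr α) ∘ₗ (cartan K).subtype = 0 := by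
    refine LinearMap.ext_on_range B.span_H fun i => ?_
    rw [LinearMap.comp_apply, Submodule.subtype_apply, ← B.basis_inl, Module.Basis.coord_apply,
      B.basis.repr_self, Finsupp.single_eq_of_ne (by simp), LinearMap.zero_apply]
  exact LinearMap.congr_fun h H

theorem ChevalleyBasis.exists_eq_cartan_add_sum (B : ChevalleyBasis a) [Fintype (roots a)]
    (x : Carrier K) :
    ∃ (H : cartan K) (c : roots a → K), x = H + ∑ α, c α • B.X α := by
  refine ⟨∑ i, B.basis.repr x (Sum.inl i) • B.H i, fun α => B.basis.repr x (Sum.inr α), ?_⟩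
  conv_lhs => rw [← B.basis.sum_repr x, Fintype.sum_sum_type]
  simp only [B.basis_inl, B.basis_inr, Submodule.coe_sum, Submodule.coe_smul]

theorem ChevalleyBasis.finite_roots (B : ChevalleyBasis a) : Finite (roots a) :=
  have := Module.Finite.finite_basis B.basis
  Finite.of_injective (Sum.inr : roots a → Fin 3 ⊕ roots a) Sum.inr_injective

variable [CharZero K] {V : Type*} [AddCommGroup V] [Module K V]
  {ρ : LieSuperalgebra.Rep (algebra a) V} {B : ChevalleyBasis a} {M : Submodule (binomRing a) V}

theorem iSupIndep_cartanStabilizer_span (B : ChevalleyBasis a)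
    (ρ : LieSuperalgebra.Rep (algebra a) V) :
    iSupIndep (fun i : Option (roots a) =>
      i.elim (cartanStabilizer ρ) fun α => Submodule.span (binomRing a) {B.X α}) := by
  refine iSupIndep_of_repr_eq_zero B.basis (Sum.elim (fun _ => none) some) ?_
  rintro (_ | α) x hx j hj
  · obtain ⟨H, rfl, -⟩ := hx
    obtain i | β := j
    · exact absurd rfl hj
    · exact B.repr_cartan_inr H β
  · obtain ⟨r, rfl⟩ := Submodule.mem_span_singleton.1 hx
    rw [Subring.smul_def, map_smul, ← B.basis_inr, B.basis.repr_self, Finsupp.smul_apply,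
      Finsupp.single_eq_of_ne (by rintro rfl; exact hj rfl), smul_zero]

variable [FiniteDimensional K V]

theorem IsAdmissible.stabilizer_le (ha₀ : a ≠ 0) (ha₁ : a ≠ -1)
    (hρ : Function.Injective ρ.toHom) (hV : ⨆ μ, weightSpace ρ μ = ⊤) (hM : IsAdmissible B ρ M) :
    ρ.stabilizer M ≤ cartanStabilizer ρ ⊔
      ⨆ α : roots a, Submodule.span (binomRing a) {B.X α} := by
  intro x (hx : ρ.toHom x ∈ latticeEnd M)
  have := B.finite_roots
  cases nonempty_fintype (roots a)
  obtain ⟨H, c, rfl⟩ := B.exists_eq_cartan_add_sum x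
  let Z : Option (roots a) → Module.End K V := fun i =>
    i.elim (ρ.toHom (H : Carrier K)) fun α => c α • ρ.toHom (B.X α)
  let β : Option (roots a) → Module.Dual K (cartan K) := fun i => i.elim 0 Subtype.val
  have hβ : Function.Injective β := by
    rintro (_ | α) (_ | α') h
    · rfl
    · exact absurd h.symm (ne_zero_of_mem_roots α'.2)
    · exact absurd h (ne_zero_of_mem_roots α.2)
    · exact congrArg some (Subtype.ext h)
  have hZ : ∀ i μ, ∀ v ∈ weightSpace ρ μ, Z i v ∈ weightSpace ρ (μ + β i) := by
    rintro (_ | α) μ v hv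
    · rw [show μ + β none = μ from add_zero μ]
      exact (mem_weightSpace ρ μ v).1 hv H ▸ Submodule.smul_mem _ _ hv
    · obtain ⟨j, hj⟩ := B.homogeneous α
      exact Submodule.smul_mem _ _ (toHom_apply_mem_weightSpace ρ (B.X_mem_rootSpace α) hj hv)
  have hcomp (i) : Z i ∈ latticeEnd M := by
    refine hM.component_mem_latticeEnd ha₀ ha₁ hV hβ hZ ?_ i
    simpa [Fintype.sum_option, Z] using hx
  refine Submodule.add_mem_sup ⟨H, rfl, ?_⟩ (sum_mem fun α _ => ?_)
  · exact (hM.toHom_cartan_mem_latticeEnd_iff ha₀ ha₁ hV H).1 (hcomp none)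
  · have hc := hM.mem_binomRing_of_smul_mem ha₀ ha₁ hρ hV (hcomp (some α))
    exact Submodule.mem_iSup_of_mem α
      (Submodule.smul_mem _ (⟨c α, hc⟩ : binomRing a) (Submodule.mem_span_singleton_self _))

theorem IsAdmissible.le_stabilizer (ha₀ : a ≠ 0) (ha₁ : a ≠ -1) (hV : ⨆ μ, weightSpace ρ μ = ⊤)
    (hM : IsAdmissible B ρ M) :
    cartanStabilizer ρ ⊔ ⨆ α : roots a, Submodule.span (binomRing a) {B.X α} ≤
      ρ.stabilizer M := by
  refine sup_le ?_ (iSup_le fun α => ?_)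
  · rintro _ ⟨H, rfl, hH⟩
    exact (hM.toHom_cartan_mem_latticeEnd_iff ha₀ ha₁ hV H).2 hH
  · rw [Submodule.span_singleton_le_iff_mem]
    exact hM.toHom_X_mem α

theorem IsAdmissible.stabilizer_eq (ha₀ : a ≠ 0) (ha₁ : a ≠ -1)
    (hρ : Function.Injective ρ.toHom) (hV : ⨆ μ, weightSpace ρ μ = ⊤) (hM : IsAdmissible B ρ M) :
    ρ.stabilizer M = cartanStabilizer ρ ⊔
      ⨆ α : roots a, Submodule.span (binomRing a) {B.X α} :=
  (hM.stabilizer_le ha₀ ha₁ hρ hV).antisymm (hM.le_stabilizer ha₀ ha₁ hV)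

theorem isLatticeOver_cartanStabilizer_sup (ha₀ : a ≠ 0) (ha₁ : a ≠ -1) (B : ChevalleyBasis a)
    (hρ : Function.Injective ρ.toHom) (hV : ⨆ μ, weightSpace ρ μ = ⊤) :
    IsLatticeOver (binomRing a) (cartanStabilizer ρ ⊔
      ⨆ α : roots a, Submodule.span (binomRing a) {B.X α}) := by
  obtain ⟨n, d, hd⟩ := exists_basis_cartanStabilizer_eq_span ha₀ ha₁ B hρ hV
  have hspan : Submodule.span K (Set.range fun i => (d i : Carrier K)) =
      Submodule.span K (Set.range fun i => (B.H i : Carrier K)) := by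
    have h := congrArg (Submodule.map (cartan K).subtype) (d.span_eq.trans B.span_H.symm)
    rwa [Submodule.map_span, Submodule.map_span, ← Set.range_comp, ← Set.range_comp] at h
  obtain ⟨-, hX, hdisj⟩ := linearIndependent_sum.1 B.linearIndependent
  refine ⟨Set.range (Sum.elim (fun i => (d i : Carrier K)) B.X),
    LinearIndependent.linearIndepOn_id (.sum_type ?_ hX ?_), ?_, ?_⟩
  · exact d.linearIndependent.map' (cartan K).subtype (Submodule.ker_subtype _)
  · exact hspan ▸ hdisj
  · have htop := B.span_eq_top
    rwa [Set.Sum.elim_range, Submodule.span_union, ← hspan, ← Submodule.span_union,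
      ← Set.Sum.elim_range] at htop
  · rw [hd, Set.Sum.elim_range, Submodule.span_union, Submodule.span_range_eq_iSup (v := B.X)]

end Stabilizer

end D21

end

theorem mainTheorem9_general {K : Type*} [Field K] [CharZero K] (a : K)
    (ha₀ : a ≠ 0) (ha₁ : a ≠ -1) (B : D21.ChevalleyBasis a)
    {V : Type*} [AddCommGroup V] [Module K V] [FiniteDimensional K V]
    (ρ : LieSuperalgebra.Rep (D21.algebra a) V) (hfaithful : Function.Injective ρ.toHom)
    (hV : ⨆ μ, D21.weightSpace ρ μ = ⊤)
    (M : Submodule (D21.binomRing a) V) (hM : D21.IsAdmissible B ρ M) :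
    (ρ.stabilizer M = D21.cartanStabilizer ρ ⊔
        (⨆ α : D21.roots a, Submodule.span (D21.binomRing a) {B.X α}) ∧
      iSupIndep (fun i : Option (D21.roots a) =>
        i.elim (D21.cartanStabilizer ρ) fun α => Submodule.span (D21.binomRing a) {B.X α})) ∧
    IsLatticeOver (D21.binomRing a) (ρ.stabilizer M) ∧
    ∀ M' : Submodule (D21.binomRing a) V, D21.IsAdmissible B ρ M' →
      ρ.stabilizer M' = ρ.stabilizer M := by
  have hstab := hM.stabilizer_eq ha₀ ha₁ hfaithful hV
  refine ⟨⟨hstab, D21.iSupIndep_cartanStabilizer_span B ρ⟩, ?_, fun M' hM' => ?_⟩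
  · rw [hstab]
    exact D21.isLatticeOver_cartanStabilizer_sup ha₀ ha₁ B hfaithful hV
  · rw [hstab, hM'.stabilizer_eq ha₀ ha₁ hfaithful hV]

theorem mainTheorem9 {K : Type*} [Field K] [IsAlgClosed K] [CharZero K] (a : K)
    (ha₀ : a ≠ 0) (ha₁ : a ≠ -1) (B : D21.ChevalleyBasis a)
    {V : Type*} [AddCommGroup V] [Module K V] [FiniteDimensional K V]
    (ρ : LieSuperalgebra.Rep (D21.algebra a) V) (hfaithful : Function.Injective ρ.toHom)
    (hrational : D21.IsRational B ρ)
    (M : Submodule (D21.binomRing a) V) (hM : D21.IsAdmissible B ρ M) :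
    (ρ.stabilizer M = D21.cartanStabilizer ρ ⊔
        (⨆ α : D21.roots a, Submodule.span (D21.binomRing a) {B.X α}) ∧
      iSupIndep (fun i : Option (D21.roots a) =>
        i.elim (D21.cartanStabilizer ρ) fun α => Submodule.span (D21.binomRing a) {B.X α})) ∧
    IsLatticeOver (D21.binomRing a) (ρ.stabilizer M) ∧
    ∀ M' : Submodule (D21.binomRing a) V, D21.IsAdmissible B ρ M' →
      ρ.stabilizer M' = ρ.stabilizer M :=
  mainTheorem9_general a ha₀ ha₁ B ρ hfaithful hrational.iSup_weightSpace M hM
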